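/- Let $(M,g)$ be a smooth $n$-dimensional Riemannian manifold without boundary, not necessarily complete, with Riemannian distance $d_g$ (the infimum of the lengths of curves between two points), and write $B_g(p,R)=\{x\in M : d_g(p,x)<R\}$ for $R>0$. Let $\Omega\subset M$ be a domain (a connected open set) such that $\overline{\Omega}$ is compact, and let $B_g(p,R)\subseteq\Omega$. Then for every $q\in\partial B_g(p,R)$ there exists a minimizing geodesic $\gamma:[0,1]\to\overline{B_g(p,R)}$ (a geodesic whose length equals $d_g(p,q)$) such that $\gamma(0)=p$, $\gamma(1)=q$ and $\gamma(t)\in B_g(p,R)$ for all $t\in[0,1)$. Moreover $B_g(p,R)$ is star-shaped along geodesics about $p$: for every $q\in B_g(p,R)$ there exists a minimizing geodesic $\gamma:[0,1]\to B_g(p,R)$ with $\gamma(0)=p$ and $\gamma(1)=q$. -/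

import Mathlib

open scoped Manifold ContDiff ENNReal Bundle

namespace RiemannianGeodesic

open Bundle

noncomputable section

/-- The `i`-th vector of the standard basis of `ℝⁿ`. -/
def basisVec (n : ℕ) (i : Fin n) : EuclideanSpace ℝ (Fin n) := EuclideanSpace.single i 1

section Riemannian

variable {n : ℕ} {M : Type*} [TopologicalSpace M] [ChartedSpace (EuclideanSpace ℝ (Fin n)) M]

/-- The coordinate vector field `∂/∂xⁱ` of the chart `φ`, at the point of coordinates `y`
(meaningful for `y ∈ φ.target`). -/
def coordVec (φ : OpenPartialHomeomorph M (EuclideanSpace ℝ (Fin n)))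
    (y : EuclideanSpace ℝ (Fin n)) (i : Fin n) : TangentSpace (𝓡 n) (φ.symm y) :=
  mfderiv (𝓡 n) (𝓡 n) φ.symm y (basisVec n i)

variable [RiemannianBundle (fun x : M ↦ TangentSpace (𝓡 n) x)]

/-- The matrix `g_ij = g(∂/∂xⁱ, ∂/∂xʲ)` of the Riemannian metric in the chart `φ`, at the point of
coordinates `y`. -/
def metricMatrix (φ : OpenPartialHomeomorph M (EuclideanSpace ℝ (Fin n)))
    (y : EuclideanSpace ℝ (Fin n)) : Matrix (Fin n) (Fin n) ℝ :=
  Matrix.of fun i j ↦ inner ℝ (coordVec φ y i) (coordVec φ y j)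

/-- The partial derivative `∂_k g_ij` in the chart `φ`, at the point of coordinates `y`. -/
def metricPartial (φ : OpenPartialHomeomorph M (EuclideanSpace ℝ (Fin n)))
    (y : EuclideanSpace ℝ (Fin n)) (k i j : Fin n) : ℝ :=
  fderiv ℝ (fun z ↦ metricMatrix φ z i j) y (basisVec n k)

/-- The Christoffel symbol
`Γᵏ_ij = ½ ∑_l gᵏˡ (∂_i g_jl + ∂_j g_il - ∂_l g_ij)` of the Levi-Civita connection in the
chart `φ`, at the point of coordinates `y`. -/
def christoffel (φ : OpenPartialHomeomorph M (EuclideanSpace ℝ (Fin n)))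
    (y : EuclideanSpace ℝ (Fin n)) (k i j : Fin n) : ℝ :=
  (1 / 2 : ℝ) * ∑ l : Fin n, (metricMatrix φ y)⁻¹ k l *
    (metricPartial φ y i j l + metricPartial φ y j i l - metricPartial φ y l i j)

/-- The curve `γ`, restricted to the interval `s`, is a geodesic: it is of class `C²` and satisfies
`(xᵏ)'' + ∑_{i,j} Γᵏ_ij(x) (xⁱ)' (xʲ)' = 0`, where `x = φ ∘ γ`, in every chart `φ` of the smooth
structure. Derivatives are taken within `s`, so they are one-sided at endpoints of `s`. -/
structure IsGeodesicOn (γ : ℝ → M) (s : Set ℝ) : Prop where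
  contMDiffOn : ContMDiffOn 𝓘(ℝ, ℝ) (𝓡 n) 2 γ s
  geodesic_eq : ∀ φ ∈ IsManifold.maximalAtlas (𝓡 n) ∞ M, ∀ t ∈ s, γ t ∈ φ.source → ∀ k : Fin n,
    (derivWithin (derivWithin (fun τ ↦ φ (γ τ)) s) s t) k
      + ∑ i : Fin n, ∑ j : Fin n, christoffel φ (φ (γ t)) k i j
          * (derivWithin (fun τ ↦ φ (γ τ)) s t) i * (derivWithin (fun τ ↦ φ (γ τ)) s t) j = 0

end Riemannian

/-- `γ : [0, 1] → M` is a minimizing geodesic from `p` to `q`: a geodesic from `p` to `q` whose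
length is the Riemannian distance from `p` to `q`. -/
structure IsMinimizingGeodesic {n : ℕ} {M : Type*} [EMetricSpace M]
    [ChartedSpace (EuclideanSpace ℝ (Fin n)) M]
    [RiemannianBundle (fun x : M ↦ TangentSpace (𝓡 n) x)] (γ : ℝ → M) (p q : M) : Prop where
  isGeodesicOn : IsGeodesicOn (n := n) γ (Set.Icc 0 1)
  source : γ 0 = p
  target : γ 1 = q
  length_eq : Manifold.pathELength (𝓡 n) γ 0 1 = Manifold.riemannianEDist (𝓡 n) p q

end

end RiemannianGeodesic

/-! The manifold need not be complete, so Hopf-Rinow is replaced by the compactness of the closed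
ball, which lies in the compact closure of `Ω`. The proof is the direct method, carried out first
metrically and then in charts.

Existence. Let `L` be the distance from `p` to `q`. On a curve of length at most `L + ε`, pick for
each `s` a point at distance `s * L` from `p`. The triangle inequality leaves only an excess `ε`, so
these points satisfy `d(Γ s, Γ t) ≤ L * |s - t| + ε` (`exists_almost_geodesic`). For `s < 1` they
lie in the ball, hence in a compact set, and a limit along an ultrafilter gives `γ` with `d(γ s, γ
t) ≤ L * |s - t|` (`exists_metric_geodesic`); since the endpoints are at distance `L`, equality
holds throughout (`edist_eq_of_edist_le`).

Regularity. Near a point of a chart, the distance is the norm of the metric up to a factor `1 + ε`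
(`exists_ball_edist_symm_bounds`). Hence `γ`, read in a chart, is Lipschitz with speed at most `L`,
while every Lipschitz competitor in a small ball with the same endpoints has energy at least `L ^ 2
* (b - a)` (`sq_mul_le_integral_chartForm`). So `γ` minimizes the energy locally. The du
Bois-Reymond lemma identifies its momentum a.e. with a Lipschitz function; inverting the metric
makes the velocity continuous, then `C¹` (`exists_hasDerivWithinAt_of_energy_minimizing`). The
Euler-Lagrange equation thus holds pointwise, and solved for the acceleration it is the geodesic
equation.

The speed bound gives length at most `L`, so `γ` is minimizing. As `γ t` is at distance `t * L` from
`p`, the location of `γ` can be read off: `L = R` for a frontier point, `L < R` inside. -/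

namespace RiemannianGeodesic

set_option maxSynthPendingDepth 3

/-! ### The du Bois-Reymond lemma -/

section Variational

open MeasureTheory Set Filter
open scoped Topology


/-- A function which is bounded on `[a, b]` and a.e. measurable there is interval integrable. -/
theorem intervalIntegrable_of_bounded {E : Type*} [NormedAddCommGroup E] {a b C : ℝ} {f : ℝ → E}
    (hab : a ≤ b) (hf : AEStronglyMeasurable f (volume.restrict (uIoc a b)))
    (hC : ∀ t ∈ Icc a b, ‖f t‖ ≤ C) : IntervalIntegrable f volume a b := by
  rw [intervalIntegrable_iff]
  have : IsFiniteMeasure (volume.restrict (uIoc a b)) := ⟨by simp⟩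
  refine (integrable_const C).mono' hf ?_
  refine (ae_restrict_iff' measurableSet_uIoc).2 (.of_forall fun t ht ↦ hC t ?_)
  rw [uIoc_of_le hab] at ht
  exact Ioc_subset_Icc_self ht

theorem exists_lipschitzWith_integral {a C : ℝ} {h : ℝ → ℝ}
    (hm : Measurable h) (hC : ∀ t, ‖h t‖ ≤ C) :
    ∃ K, LipschitzWith K (fun t ↦ ∫ s in a..t, h s) := by
  refine ⟨C.toNNReal, LipschitzWith.of_dist_le_mul fun s t ↦ ?_⟩
  have hi : ∀ c d, IntervalIntegrable h volume c d := fun c d ↦ by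
    rw [intervalIntegrable_iff]
    exact Measure.integrableOn_of_bounded (M := C) (by simp) hm.aestronglyMeasurable
      (.of_forall hC)
  have hC0 : 0 ≤ C := (norm_nonneg _).trans (hC 0)
  rw [dist_eq_norm, intervalIntegral.integral_interval_sub_left (hi _ _) (hi _ _),
    Real.coe_toNNReal _ hC0, Real.dist_eq]
  exact intervalIntegral.norm_integral_le_of_norm_le_const fun x _ ↦ hC x

/-- The du Bois-Reymond lemma for bounded measurable functions. -/
theorem ae_eq_const_add_integral_of_forall_integral_eq_zero {a b B : ℝ} (hab : a < b)
    {F P : ℝ → ℝ} (hF : Measurable F) (hP : Measurable P)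
    (hFB : ∀ t, ‖F t‖ ≤ B) (hPB : ∀ t, ‖P t‖ ≤ B)
    (H : ∀ h : ℝ → ℝ, Measurable h → (∃ C, ∀ t, ‖h t‖ ≤ C) → ∫ t in a..b, h t = 0 →
      ∫ t in a..b, (F t * (∫ s in a..t, h s) + P t * h t) = 0) :
    ∃ c, ∀ᵐ t, t ∈ Icc a b → P t = c + ∫ s in a..t, F s := by
  have hint : ∀ f : ℝ → ℝ, Measurable f → ∀ C, (∀ t, ‖f t‖ ≤ C) → ∀ c d,
      IntervalIntegrable f volume c d := fun f hf C hC c d ↦ by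
    rw [intervalIntegrable_iff]
    exact Measure.integrableOn_of_bounded (M := C) (by simp) hf.aestronglyMeasurable
      (.of_forall hC)
  set Φ : ℝ → ℝ := fun t ↦ ∫ s in a..t, F s with hΦ
  obtain ⟨K, hK⟩ := exists_lipschitzWith_integral (a := a) hF hFB
  have hΦc : Continuous Φ := hK.continuous
  -- The mean of `P - Φ`, so that the test function `h = P - Φ - c` has integral zero. Testing with
  -- this `h` yields `∫ h ^ 2 = 0`.
  set c : ℝ := (b - a)⁻¹ * ∫ t in a..b, (P t - Φ t) with hc
  set h : ℝ → ℝ := (Icc a b).indicator fun t ↦ P t - Φ t - c with hh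
  have hhm : Measurable h := ((hP.sub hΦc.measurable).sub_const c).indicator measurableSet_Icc
  obtain ⟨D, hD⟩ := isCompact_Icc.exists_bound_of_continuousOn (hΦc.continuousOn (s := Icc a b))
  have hhB : ∀ t, ‖h t‖ ≤ B + D + ‖c‖ := fun t ↦ by
    by_cases ht : t ∈ Icc a b
    · rw [hh, indicator_of_mem ht]
      exact (norm_sub_le _ _).trans (add_le_add_left ((norm_sub_le _ _).trans
        (add_le_add (hPB t) (hD t ht))) _)
    · rw [hh, indicator_of_notMem ht, norm_zero]
      have h1 := (norm_nonneg _).trans (hPB 0)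
      have h2 := (norm_nonneg _).trans (hD a ⟨le_rfl, hab.le⟩)
      positivity
  have hIh := hint h hhm _ hhB
  have hIP := hint P hP B hPB
  have hIΦ : ∀ c d, IntervalIntegrable Φ volume c d := fun c d ↦ hΦc.intervalIntegrable c d
  have hcongr : ∀ f : ℝ → ℝ, ∫ t in a..b, f t * h t = ∫ t in a..b, f t * (P t - Φ t - c) :=
    fun f ↦ intervalIntegral.integral_congr fun t ht ↦ by
      rw [uIcc_of_le hab.le] at ht
      simp only [hh, indicator_of_mem ht]
  have h0 : ∫ t in a..b, h t = 0 := by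
    have := hcongr 1
    simp only [Pi.one_apply, one_mul] at this
    rw [this, intervalIntegral.integral_sub ((hIP _ _).sub (hIΦ _ _)) (by simp),
      intervalIntegral.integral_const, hc, smul_eq_mul]
    field_simp [(sub_pos.2 hab).ne']
    ring
  obtain ⟨K', hK'⟩ := exists_lipschitzWith_integral (a := a) hhm hhB
  set u : ℝ → ℝ := fun t ↦ ∫ s in a..t, h s with hu
  -- Integration by parts between two Lipschitz primitives; the boundary terms vanish because `u a =
  -- u b = 0`.
  have hparts : ∫ t in a..b, F t * u t = - ∫ t in a..b, Φ t * h t := by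
    have hac1 := (hK.lipschitzOnWith (s := uIcc a b)).absolutelyContinuousOnInterval
    have hac2 := (hK'.lipschitzOnWith (s := uIcc a b)).absolutelyContinuousOnInterval
    have key := hac2.integral_mul_deriv_eq_deriv_mul hac1
    have e1 : ∫ t in a..b, u t * deriv Φ t = ∫ t in a..b, F t * u t := by
      apply intervalIntegral.integral_congr_ae
      filter_upwards [(hint F hF B hFB a b).ae_hasDerivAt_integral] with t ht h't
      rw [(ht (uIoc_subset_uIcc h't) a (by simp)).deriv, mul_comm]
    have e2 : ∫ t in a..b, deriv u t * Φ t = ∫ t in a..b, Φ t * h t := by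
      apply intervalIntegral.integral_congr_ae
      filter_upwards [(hIh a b).ae_hasDerivAt_integral] with t ht h't
      rw [(ht (uIoc_subset_uIcc h't) a (by simp)).deriv, mul_comm]
    have hub : u b = 0 := h0
    have hua : u a = 0 := by simp [hu]
    rw [← e1, key, ← e2]
    change u b * Φ b - u a * Φ a - _ = _
    rw [hub, hua]; ring
  have hFu : IntervalIntegrable (fun t ↦ F t * u t) volume a b :=
    (hint F hF B hFB a b).mul_continuousOn hK'.continuous.continuousOn
  have hPh : IntervalIntegrable (fun t ↦ P t * h t) volume a b :=
    hint (fun t ↦ P t * h t) (hP.mul hhm) (B * (B + D + ‖c‖)) (fun t ↦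
      (norm_mul _ _).trans_le <|
        mul_le_mul (hPB t) (hhB t) (norm_nonneg _) ((norm_nonneg _).trans (hPB 0))) a b
  have hΦh : IntervalIntegrable (fun t ↦ Φ t * h t) volume a b :=
    (hIh a b).continuousOn_mul hΦc.continuousOn
  have hzero := H h hhm ⟨_, hhB⟩ h0
  rw [intervalIntegral.integral_add hFu hPh, hparts] at hzero
  have hsq : ∫ t in a..b, h t * h t = 0 := by
    have e : ∫ t in a..b, h t * h t = ∫ t in a..b, (P t * h t - Φ t * h t - c * h t) :=
      intervalIntegral.integral_congr fun t ht ↦ by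
        rw [uIcc_of_le hab.le] at ht
        simp only [hh, indicator_of_mem ht]
        ring
    rw [e, intervalIntegral.integral_sub (hPh.sub hΦh) ((hIh a b).const_mul c),
      intervalIntegral.integral_sub hPh hΦh, intervalIntegral.integral_const_mul, h0]
    linarith
  have hhh : IntervalIntegrable (fun t ↦ h t * h t) volume a b :=
    hint (fun t ↦ h t * h t) (hhm.mul hhm) ((B + D + ‖c‖) * (B + D + ‖c‖)) (fun t ↦
      (norm_mul _ _).trans_le <|
        mul_le_mul (hhB t) (hhB t) (norm_nonneg _) ((norm_nonneg _).trans (hhB 0))) a b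
  rw [intervalIntegral.integral_eq_zero_iff_of_nonneg_ae
    (.of_forall fun t ↦ mul_self_nonneg (h t)) hhh, Ioc_eq_empty (not_lt.2 hab.le), union_empty,
    EventuallyEq, ae_restrict_iff' measurableSet_Ioc] at hsq
  refine ⟨c, ?_⟩
  have hne : ∀ᵐ t : ℝ, t ≠ a := by simp [ae_iff, measure_singleton]
  filter_upwards [hsq, hne] with t ht hta h't
  have := ht ⟨lt_of_le_of_ne h't.1 (Ne.symm hta), h't.2⟩
  simp only [Pi.zero_apply, mul_self_eq_zero, hh, indicator_of_mem h't] at this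
  change P t = c + Φ t
  linarith

end Variational

/-! ### First variation of the energy -/

section Variational

open MeasureTheory Set Filter
open scoped Topology

attribute [-instance]
  Bundle.instNormedAddCommGroupOfRiemannianBundleOfIsTopologicalAddGroupOfContinuousConstSMulReal
  Bundle.instInnerProductSpaceReal


variable {E : Type*} [NormedAddCommGroup E] [NormedSpace ℝ E] [FiniteDimensional ℝ E]

set_option maxHeartbeats 2000000 in
/-- The first variation formula for the energy of a Lipschitz curve. -/
theorem integral_first_variation_eq_zero {V : Set E} (hV : IsOpen V)
    {g : E → E →L[ℝ] E →L[ℝ] ℝ} (hg : ContDiffOn ℝ 1 g V) {C : ℝ}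
    (hC : ∀ y ∈ V, ‖g y‖ ≤ C) (hC' : ∀ y ∈ V, ‖fderiv ℝ g y‖ ≤ C)
    (hsymm : ∀ y ∈ V, ∀ v w, g y v w = g y w v) {a b : ℝ} (hab : a < b) {x : ℝ → E} {K : NNReal}
    (hx : LipschitzWith K x) {δ : ℝ} (hδ : 0 < δ) (hxV : ∀ t, Metric.ball (x t) δ ⊆ V)
    (hmin : ∀ y : ℝ → E, (∃ K', LipschitzWith K' y) → (∀ t ∈ Icc a b, y t ∈ V) → y a = x a →
      y b = x b → ∫ t in a..b, g (x t) (deriv x t) (deriv x t) ≤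
        ∫ t in a..b, g (y t) (deriv y t) (deriv y t))
    (e : E) {h : ℝ → ℝ} {B : ℝ} (hm : Measurable h) (hB : ∀ t, ‖h t‖ ≤ B)
    (h0 : ∫ t in a..b, h t = 0) :
    ∫ t in a..b, ((1 / 2) * fderiv ℝ g (x t) e (deriv x t) (deriv x t) * (∫ s in a..t, h s) +
      g (x t) (deriv x t) e * h t) = 0 := by
  obtain ⟨Ku, hu⟩ := exists_lipschitzWith_integral (a := a) hm hB
  set u : ℝ → ℝ := fun t ↦ ∫ s in a..t, h s with hu_def
  obtain ⟨D, hD⟩ := isCompact_Icc.exists_bound_of_continuousOn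
    (hu.continuous.continuousOn (s := Icc a b))
  have hD0 : 0 ≤ D := (norm_nonneg _).trans (hD a ⟨le_rfl, hab.le⟩)
  have hB0 : 0 ≤ B := (norm_nonneg _).trans (hB 0)
  have hC0 : 0 ≤ C := (norm_nonneg _).trans (hC (x 0) (hxV 0 (Metric.mem_ball_self hδ)))
  have hd : ∀ t, ‖deriv x t‖ ≤ K := fun t ↦ norm_deriv_le_of_lipschitz hx
  -- As `|u| ≤ D` on `[a, b]`, the second bound keeps the varied curve within `δ` of `x`, hence in
  -- `V`; the bound `1` keeps its velocity bounded. The `+ 1` guards against a zero denominator.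
  set r : ℝ := min 1 (δ / (D * ‖e‖ + 1)) with hr_def
  have hr : 0 < r := lt_min one_pos (by positivity)
  have hmem : ∀ s ∈ Metric.ball (0 : ℝ) r, ∀ t ∈ Icc a b, x t + (s * u t) • e ∈ V := by
    intro s hs t ht
    refine hxV t ?_
    rw [Metric.mem_ball, dist_eq_norm, add_sub_cancel_left, norm_smul, norm_mul]
    rw [Metric.mem_ball, dist_zero_right] at hs
    calc ‖s‖ * ‖u t‖ * ‖e‖ ≤ (δ / (D * ‖e‖ + 1)) * D * ‖e‖ := by
          gcongr
          · exact hs.le.trans (min_le_right _ _)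
          · exact hD t ht
      _ = δ * ((D * ‖e‖) / (D * ‖e‖ + 1)) := by ring
      _ < δ * 1 := by
          gcongr
          rw [div_lt_one (by positivity)]
          linarith
      _ = δ := mul_one _
  -- The energy density of the variation `x + s u e`, with `h` standing for the derivative of `u`,
  -- to which it is equal only a.e.
  set G : ℝ → ℝ → ℝ := fun s t ↦ g (x t + (s * u t) • e) (deriv x t + (s * h t) • e)
    (deriv x t + (s * h t) • e) with hG
  set G' : ℝ → ℝ → ℝ := fun s t ↦
    fderiv ℝ g (x t + (s * u t) • e) (u t • e) (deriv x t + (s * h t) • e)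
      (deriv x t + (s * h t) • e) +
    g (x t + (s * u t) • e) (h t • e) (deriv x t + (s * h t) • e) +
    g (x t + (s * u t) • e) (deriv x t + (s * h t) • e) (h t • e) with hG'
  set W : ℝ := K + B * ‖e‖ with hW
  have hW0 : 0 ≤ W := by positivity
  have hvel : ∀ s ∈ Metric.ball (0 : ℝ) r, ∀ t, ‖deriv x t + (s * h t) • e‖ ≤ W := by
    intro s hs t
    rw [Metric.mem_ball, dist_zero_right] at hs
    have hs1 : ‖s‖ ≤ 1 := hs.le.trans (min_le_left _ _)
    refine (norm_add_le _ _).trans (add_le_add (hd t) ?_)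
    rw [norm_smul, norm_mul]
    gcongr
    calc ‖s‖ * ‖h t‖ ≤ 1 * B := mul_le_mul hs1 (hB t) (norm_nonneg _) zero_le_one
      _ = B := one_mul _
  have hcont : ∀ s, Continuous fun t ↦ x t + (s * u t) • e := fun s ↦
    hx.continuous.add ((continuous_const.mul hu.continuous).smul continuous_const)
  have huIoc : uIoc a b ⊆ Icc a b := by
    rw [uIoc_of_le hab.le]; exact Ioc_subset_Icc_self
  have hgm : ∀ s ∈ Metric.ball (0 : ℝ) r, AEStronglyMeasurable
      (fun t ↦ g (x t + (s * u t) • e)) (volume.restrict (uIoc a b)) := fun s hs ↦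
    ((hg.continuousOn.comp (hcont s).continuousOn (fun t ht ↦ hmem s hs t ht)).mono
      huIoc).aestronglyMeasurable measurableSet_uIoc
  have hg'm : ∀ s ∈ Metric.ball (0 : ℝ) r, AEStronglyMeasurable
      (fun t ↦ fderiv ℝ g (x t + (s * u t) • e)) (volume.restrict (uIoc a b)) := fun s hs ↦
    (((hg.continuousOn_fderiv_of_isOpen hV le_rfl).comp (hcont s).continuousOn
      (fun t ht ↦ hmem s hs t ht)).mono huIoc).aestronglyMeasurable measurableSet_uIoc
  have hvm : ∀ s : ℝ, AEStronglyMeasurable (fun t ↦ deriv x t + (s * h t) • e)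
      (volume.restrict (uIoc a b)) := fun s ↦
    ((stronglyMeasurable_deriv x).aestronglyMeasurable).add
      (((hm.const_mul s).aestronglyMeasurable).smul_const e)
  have hGm : ∀ s ∈ Metric.ball (0 : ℝ) r,
      AEStronglyMeasurable (G s) (volume.restrict (uIoc a b)) := fun s hs ↦
    (show Continuous fun q : (E →L[ℝ] E →L[ℝ] ℝ) × E ↦ q.1 q.2 q.2 by
      fun_prop).comp_aestronglyMeasurable ((hgm s hs).prodMk (hvm s))
  have h0r : (0 : ℝ) ∈ Metric.ball (0 : ℝ) r := Metric.mem_ball_self hr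
  have hG'm : AEStronglyMeasurable (G' 0) (volume.restrict (uIoc a b)) := by
    refine AEStronglyMeasurable.add (AEStronglyMeasurable.add ?_ ?_) ?_
    · exact (show Continuous fun q : (E →L[ℝ] E →L[ℝ] E →L[ℝ] ℝ) × E × E ↦ q.1 q.2.1 q.2.2 q.2.2
        by fun_prop).comp_aestronglyMeasurable ((hg'm 0 h0r).prodMk
          ((hu.continuous.smul continuous_const).aestronglyMeasurable.prodMk (hvm 0)))
    · exact (show Continuous fun q : (E →L[ℝ] E →L[ℝ] ℝ) × E × E ↦ q.1 q.2.1 q.2.2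
        by fun_prop).comp_aestronglyMeasurable ((hgm 0 h0r).prodMk
          ((hm.aestronglyMeasurable.smul_const e).prodMk (hvm 0)))
    · exact (show Continuous fun q : (E →L[ℝ] E →L[ℝ] ℝ) × E × E ↦ q.1 q.2.1 q.2.2
        by fun_prop).comp_aestronglyMeasurable ((hgm 0 h0r).prodMk
          ((hvm 0).prodMk (hm.aestronglyMeasurable.smul_const e)))
  have hderiv : ∀ t ∈ Icc a b, ∀ s ∈ Metric.ball (0 : ℝ) r,
      HasDerivAt (fun s ↦ G s t) (G' s t) s := by
    intro t ht s hs
    have h1 : HasDerivAt (fun s : ℝ ↦ x t + (s * u t) • e) (u t • e) s := by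
      simpa using (((hasDerivAt_id s).mul_const (u t)).smul_const e).const_add (x t)
    have h2 : HasDerivAt (fun s : ℝ ↦ deriv x t + (s * h t) • e) (h t • e) s := by
      simpa using (((hasDerivAt_id s).mul_const (h t)).smul_const e).const_add (deriv x t)
    have h3 : HasFDerivAt g (fderiv ℝ g (x t + (s * u t) • e)) (x t + (s * u t) • e) :=
      ((hg.contDiffAt (hV.mem_nhds (hmem s hs t ht))).differentiableAt one_ne_zero).hasFDerivAt
    refine (((h3.comp_hasDerivAt s h1).clm_apply h2).clm_apply h2).congr_deriv ?_
    simp only [hG', Function.comp_apply, add_apply]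
  have hbound : ∀ t ∈ Icc a b, ∀ s ∈ Metric.ball (0 : ℝ) r,
      ‖G' s t‖ ≤ C * (D * ‖e‖) * W * W + C * (B * ‖e‖) * W + C * W * (B * ‖e‖) := by
    intro t ht s hs
    have hv := hvel s hs t
    have hue : ‖u t • e‖ ≤ D * ‖e‖ := by
      rw [norm_smul]; gcongr; exact hD t ht
    have hhe : ‖h t • e‖ ≤ B * ‖e‖ := by
      rw [norm_smul]; gcongr; exact hB t
    have hy := hmem s hs t ht
    refine norm_add₃_le.trans (add_le_add (add_le_add ?_ ?_) ?_)
    · refine (ContinuousLinearMap.le_of_opNorm₂_le_of_le _ ?_ hv hv)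
      exact ContinuousLinearMap.le_of_opNorm_le_of_le _ (hC' _ hy) hue
    · exact ContinuousLinearMap.le_of_opNorm₂_le_of_le _ (hC _ hy) hhe hv
    · exact ContinuousLinearMap.le_of_opNorm₂_le_of_le _ (hC _ hy) hv hhe
  have hG0 : IntervalIntegrable (G 0) volume a b :=
    intervalIntegrable_of_bounded (C := C * W * W) hab.le (hGm 0 h0r) fun t ht ↦
      ContinuousLinearMap.le_of_opNorm₂_le_of_le _ (hC _ (hmem 0 h0r t ht)) (hvel 0 h0r t)
        (hvel 0 h0r t)
  have key := (intervalIntegral.hasDerivAt_integral_of_dominated_loc_of_deriv_le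
    (Metric.ball_mem_nhds (0 : ℝ) hr)
    (Filter.mem_of_superset (Metric.ball_mem_nhds (0 : ℝ) hr) hGm) hG0 hG'm
    (.of_forall fun t ht s hs ↦ hbound t (huIoc ht) s hs) (by simp)
    (.of_forall fun t ht s hs ↦ hderiv t (huIoc ht) s hs)).2
  have hlocmin : IsLocalMin (fun s ↦ ∫ t in a..b, G s t) 0 := by
    refine Filter.mem_of_superset (Metric.ball_mem_nhds (0 : ℝ) hr) fun s hs ↦ ?_
    have hua : u a = 0 := by simp [hu_def]
    have hub : u b = 0 := h0
    have hlip : LipschitzWith (K + ‖s‖₊ * Ku * ‖e‖₊) fun t ↦ x t + (s * u t) • e := by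
      refine hx.add (LipschitzWith.of_dist_le_mul fun t t' ↦ ?_)
      rw [dist_eq_norm, ← sub_smul, ← mul_sub, norm_smul, norm_mul]
      have := hu.dist_le_mul t t'
      rw [dist_eq_norm] at this
      push_cast
      calc ‖s‖ * ‖u t - u t'‖ * ‖e‖ ≤ ‖s‖ * (Ku * dist t t') * ‖e‖ := by gcongr
        _ = _ := by ring
    have := hmin _ ⟨_, hlip⟩ (hmem s hs) (by simp [hua]) (by simp [hub])
    have e0 : (fun t ↦ G 0 t) = fun t ↦ g (x t) (deriv x t) (deriv x t) := by
      ext t; simp [hG]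
    change ∫ t in a..b, G 0 t ≤ ∫ t in a..b, G s t
    rw [e0]
    refine this.trans_eq (intervalIntegral.integral_congr_ae ?_)
    have hIh : IntervalIntegrable h volume a b :=
      intervalIntegrable_of_bounded hab.le hm.aestronglyMeasurable (fun t _ ↦ hB t)
    filter_upwards [hx.ae_differentiableAt_real, hIh.ae_hasDerivAt_integral] with t h1 h2 ht
    have h3 := h2 (uIoc_subset_uIcc ht) a (by simp)
    have h4 := (h1.hasDerivAt.add ((h3.const_mul s).smul_const e)).deriv
    have h5 : deriv (fun t ↦ x t + (s * u t) • e) t = deriv x t + (s * h t) • e := h4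
    rw [h5]
  have hz := hlocmin.hasDerivAt_eq_zero key
  -- At `s = 0` the symmetry of `g` merges the two velocity terms of `G'`, which accounts for the
  -- factor `1 / 2`.
  have hhalf : ∫ t in a..b, ((1 / 2) * fderiv ℝ g (x t) e (deriv x t) (deriv x t) * u t +
      g (x t) (deriv x t) e * h t) = ∫ t in a..b, (1 / 2) * G' 0 t := by
    refine intervalIntegral.integral_congr fun t _ ↦ ?_
    simp only [hG', zero_mul, zero_smul, add_zero, map_smul, smul_apply,
      smul_eq_mul]
    rw [hsymm (x t) (hxV t (Metric.mem_ball_self hδ)) e]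
    ring
  rw [hhalf, intervalIntegral.integral_const_mul, hz, mul_zero]

end Variational

/-! ### Weak Euler-Lagrange equation -/

section Variational

open MeasureTheory Set Filter
open scoped Topology

attribute [-instance]
  Bundle.instNormedAddCommGroupOfRiemannianBundleOfIsTopologicalAddGroupOfContinuousConstSMulReal
  Bundle.instInnerProductSpaceReal

variable {E : Type*} [NormedAddCommGroup E] [NormedSpace ℝ E] [FiniteDimensional ℝ E]

/-- A positive definite bilinear form identifies a finite-dimensional space with its dual. -/
theorem exists_continuousLinearEquiv_of_pos {B : E →L[ℝ] E →L[ℝ] ℝ}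
    (hB : ∀ v, v ≠ 0 → 0 < B v v) : ∃ e : E ≃L[ℝ] (E →L[ℝ] ℝ), (e : E →L[ℝ] E →L[ℝ] ℝ) = B := by
  have hinj : Function.Injective (B : E →ₗ[ℝ] E →L[ℝ] ℝ) := by
    rw [injective_iff_map_eq_zero]
    intro v hv
    by_contra hne
    have h1 := hB v hne
    have h2 : B v = 0 := hv
    simp [h2] at h1
  have hdim : Module.finrank ℝ E = Module.finrank ℝ (E →L[ℝ] ℝ) := by
    rw [← (LinearMap.toContinuousLinearMap (𝕜 := ℝ) (E := E) (F' := ℝ)).finrank_eq]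
    exact (Subspace.dual_finrank_eq (K := ℝ) (V := E)).symm
  refine ⟨(LinearMap.linearEquivOfInjective (B : E →ₗ[ℝ] E →L[ℝ] ℝ) hinj
    hdim).toContinuousLinearEquiv, ?_⟩
  ext v w
  rfl

/-- Composing with a continuous functional reduces to real absolutely continuous functions, and
functionals separate points. -/
theorem eq_add_integral_deriv_of_lipschitzWith {x : ℝ → E} {K : NNReal} (hx : LipschitzWith K x)
    {a t : ℝ} : x t = x a + ∫ s in a..t, deriv x s := by
  have hint : IntervalIntegrable (deriv x) volume a t := by
    rw [intervalIntegrable_iff]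
    exact Measure.integrableOn_of_bounded (M := K) (by simp)
      (stronglyMeasurable_deriv x).aestronglyMeasurable
      (.of_forall fun s ↦ norm_deriv_le_of_lipschitz hx)
  rw [← sub_eq_iff_eq_add', ← sub_eq_zero]
  refine (SeparatingDual.eq_zero_iff_forall_dual_eq_zero (R := ℝ) _).2 fun ℓ ↦ ?_
  rw [map_sub, map_sub, ← ContinuousLinearMap.intervalIntegral_comp_comm ℓ hint, sub_eq_zero]
  have hac : AbsolutelyContinuousOnInterval (fun s ↦ ℓ (x s)) a t :=
    ((ℓ.lipschitz.comp hx).lipschitzOnWith (s := uIcc a t)).absolutelyContinuousOnInterval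
  rw [← hac.integral_deriv_eq_sub]
  refine intervalIntegral.integral_congr_ae ?_
  filter_upwards [hx.ae_differentiableAt_real] with s hs _
  exact (ℓ.hasFDerivAt.comp_hasDerivAt s hs.hasDerivAt).deriv

/-- The weak Euler-Lagrange equation, in integrated form. -/
theorem exists_ae_eq_const_add_integral {V : Set E} (hV : IsOpen V)
    {g : E → E →L[ℝ] E →L[ℝ] ℝ} (hg : ContDiffOn ℝ 1 g V) {C : ℝ}
    (hC : ∀ y ∈ V, ‖g y‖ ≤ C) (hC' : ∀ y ∈ V, ‖fderiv ℝ g y‖ ≤ C)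
    (hsymm : ∀ y ∈ V, ∀ v w, g y v w = g y w v) {a b : ℝ} (hab : a < b) {x : ℝ → E} {K : NNReal}
    (hx : LipschitzWith K x) {δ : ℝ} (hδ : 0 < δ) (hxV : ∀ t, Metric.ball (x t) δ ⊆ V)
    (hmin : ∀ y : ℝ → E, (∃ K', LipschitzWith K' y) → (∀ t ∈ Icc a b, y t ∈ V) → y a = x a →
      y b = x b → ∫ t in a..b, g (x t) (deriv x t) (deriv x t) ≤
        ∫ t in a..b, g (y t) (deriv y t) (deriv y t)) (e : E) :
    ∃ c : ℝ, ∀ᵐ t, t ∈ Icc a b → g (x t) (deriv x t) e =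
      c + ∫ s in a..t, (1 / 2) * fderiv ℝ g (x s) e (deriv x s) (deriv x s) := by
  have hxm : ∀ t, x t ∈ V := fun t ↦ hxV t (Metric.mem_ball_self hδ)
  have hC0 : 0 ≤ C := (norm_nonneg _).trans (hC (x 0) (hxm 0))
  have hgc : Continuous fun t ↦ g (x t) := hg.continuousOn.comp_continuous hx.continuous hxm
  have hgc' : Continuous fun t ↦ fderiv ℝ g (x t) :=
    (hg.continuousOn_fderiv_of_isOpen hV le_rfl).comp_continuous hx.continuous hxm
  have hd : ∀ t, ‖deriv x t‖ ≤ K := fun t ↦ norm_deriv_le_of_lipschitz hx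
  have hdm := stronglyMeasurable_deriv x
  have hcF : Continuous fun q : (E →L[ℝ] E →L[ℝ] E →L[ℝ] ℝ) × E ↦ q.1 e q.2 q.2 := by fun_prop
  have hcP : Continuous fun q : (E →L[ℝ] E →L[ℝ] ℝ) × E ↦ q.1 q.2 e := by fun_prop
  have hF : Measurable fun t ↦ (1 / 2) * fderiv ℝ g (x t) e (deriv x t) (deriv x t) :=
    ((hcF.comp_stronglyMeasurable
      (hgc'.stronglyMeasurable.prodMk hdm)).measurable).const_mul _
  have hP : Measurable fun t ↦ g (x t) (deriv x t) e :=
    (hcP.comp_stronglyMeasurable (hgc.stronglyMeasurable.prodMk hdm)).measurable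
  have hFB : ∀ t, ‖(1 / 2) * fderiv ℝ g (x t) e (deriv x t) (deriv x t)‖ ≤ C * ‖e‖ * K * K :=
    fun t ↦ by
    have h1 : ‖fderiv ℝ g (x t) e (deriv x t) (deriv x t)‖ ≤ C * ‖e‖ * K * K :=
      ContinuousLinearMap.le_of_opNorm₂_le_of_le _
        (ContinuousLinearMap.le_of_opNorm_le_of_le _ (hC' _ (hxm t)) le_rfl) (hd t) (hd t)
    rw [norm_mul]
    have h2 : ‖(1 / 2 : ℝ)‖ = 1 / 2 := by norm_num
    rw [h2]
    linarith [norm_nonneg (fderiv ℝ g (x t) e (deriv x t) (deriv x t))]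
  have hPB : ∀ t, ‖g (x t) (deriv x t) e‖ ≤ C * K * ‖e‖ := fun t ↦
    ContinuousLinearMap.le_of_opNorm₂_le_of_le _ (hC _ (hxm t)) (hd t) le_rfl
  refine ae_eq_const_add_integral_of_forall_integral_eq_zero (B := C * ‖e‖ * K * K + C * K * ‖e‖)
    hab hF hP (fun t ↦ (hFB t).trans (le_add_of_nonneg_right (by positivity)))
    (fun t ↦ (hPB t).trans (le_add_of_nonneg_left (by positivity))) ?_
  rintro h hm ⟨B, hB⟩ h0
  exact integral_first_variation_eq_zero hV hg hC hC' hsymm hab hx hδ hxV hmin e hm hB h0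

end Variational

/-! ### Regularity of energy minimizers -/

section Variational

open MeasureTheory Set Filter
open scoped Topology

attribute [-instance]
  Bundle.instNormedAddCommGroupOfRiemannianBundleOfIsTopologicalAddGroupOfContinuousConstSMulReal
  Bundle.instInnerProductSpaceReal

variable {E : Type*} [NormedAddCommGroup E] [NormedSpace ℝ E] [FiniteDimensional ℝ E]

/-- Minimizers of the energy are of class `C²` and satisfy the Euler-Lagrange equation. -/
theorem exists_hasDerivWithinAt_of_energy_minimizing {V : Set E} (hV : IsOpen V)
    {g : E → E →L[ℝ] E →L[ℝ] ℝ} (hg : ContDiffOn ℝ 1 g V) {C : ℝ}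
    (hC : ∀ y ∈ V, ‖g y‖ ≤ C) (hC' : ∀ y ∈ V, ‖fderiv ℝ g y‖ ≤ C)
    (hsymm : ∀ y ∈ V, ∀ v w, g y v w = g y w v) (hpos : ∀ y ∈ V, ∀ v, v ≠ 0 → 0 < g y v v)
    {a b : ℝ} (hab : a < b) {x : ℝ → E} {K : NNReal}
    (hx : LipschitzWith K x) {δ : ℝ} (hδ : 0 < δ) (hxV : ∀ t, Metric.ball (x t) δ ⊆ V)
    (hmin : ∀ y : ℝ → E, (∃ K', LipschitzWith K' y) → (∀ t ∈ Icc a b, y t ∈ V) → y a = x a →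
      y b = x b → ∫ t in a..b, g (x t) (deriv x t) (deriv x t) ≤
        ∫ t in a..b, g (y t) (deriv y t) (deriv y t)) :
    ∃ v w : ℝ → E, Continuous w ∧
      (∀ t ∈ Icc a b, HasDerivWithinAt x (v t) (Icc a b) t) ∧
      (∀ t ∈ Icc a b, HasDerivWithinAt v (w t) (Icc a b) t) ∧
      ∀ t ∈ Icc a b, ∀ e, g (x t) (w t) e + fderiv ℝ g (x t) (v t) (v t) e =
        (1 / 2) * fderiv ℝ g (x t) e (v t) (v t) := by
  have hxm : ∀ t, x t ∈ V := fun t ↦ hxV t (Metric.mem_ball_self hδ)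
  have hgd : ∀ y ∈ V, HasFDerivAt g (fderiv ℝ g y) y := fun y hy ↦
    ((hg.contDiffAt (hV.mem_nhds hy)).differentiableAt one_ne_zero).hasFDerivAt
  have hgc' : Continuous fun t ↦ fderiv ℝ g (x t) :=
    (hg.continuousOn_fderiv_of_isOpen hV le_rfl).comp_continuous hx.continuous hxm
  -- the inverse of the metric
  set A : E → (E →L[ℝ] ℝ) →L[ℝ] E := fun y ↦ (g y).inverse with hA
  have hAinv : ∀ y ∈ V, (∀ v, A y (g y v) = v) ∧ ∀ ℓ, g y (A y ℓ) = ℓ := by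
    intro y hy
    obtain ⟨e, he⟩ := exists_continuousLinearEquiv_of_pos (hpos y hy)
    simp only [hA, ← he, ContinuousLinearMap.inverse_equiv]
    exact ⟨fun v ↦ e.symm_apply_apply v, fun ℓ ↦ e.apply_symm_apply ℓ⟩
  have hAs : ContDiffOn ℝ 1 A V := by
    intro y hy
    obtain ⟨e, he⟩ := exists_continuousLinearEquiv_of_pos (hpos y hy)
    have h1 := contDiffAt_map_inverse (n := 1) e
    rw [he] at h1
    exact (h1.comp y (hg.contDiffAt (hV.mem_nhds hy))).contDiffWithinAt
  have hAd : ∀ y ∈ V, HasFDerivAt A (fderiv ℝ A y) y := fun y hy ↦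
    ((hAs.contDiffAt (hV.mem_nhds hy)).differentiableAt one_ne_zero).hasFDerivAt
  have hAc : Continuous fun t ↦ A (x t) := hAs.continuousOn.comp_continuous hx.continuous hxm
  have hAc' : Continuous fun t ↦ fderiv ℝ A (x t) :=
    (hAs.continuousOn_fderiv_of_isOpen hV le_rfl).comp_continuous hx.continuous hxm
  -- the momentum, obtained coordinate by coordinate
  let β := Module.finBasis ℝ E
  let pr : Fin (Module.finrank ℝ E) → E →L[ℝ] ℝ := fun i ↦
    LinearMap.toContinuousLinearMap (β.coord i)
  have hexp : ∀ ℓ : E →L[ℝ] ℝ, ℓ = ∑ i, ℓ (β i) • pr i := by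
    intro ℓ
    ext w
    conv_lhs => rw [← β.sum_repr w, map_sum]
    simp [pr, -Module.Basis.sum_repr, mul_comm]
  -- The exceptional null set of the weak equation depends on the test vector; a basis leaves only
  -- finitely many of them.
  choose c hc using fun i ↦ exists_ae_eq_const_add_integral hV hg hC hC' hsymm hab hx hδ hxV
    hmin (β i)
  set f : Fin (Module.finrank ℝ E) → ℝ → ℝ := fun i s ↦
    (1 / 2) * fderiv ℝ g (x s) (β i) (deriv x s) (deriv x s) with hf
  have hd : ∀ t, ‖deriv x t‖ ≤ K := fun t ↦ norm_deriv_le_of_lipschitz hx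
  have hfm : ∀ i, Measurable (f i) := fun i ↦ by
    have hcF : Continuous fun q : (E →L[ℝ] E →L[ℝ] E →L[ℝ] ℝ) × E ↦ q.1 (β i) q.2 q.2 := by
      fun_prop
    exact ((hcF.comp_stronglyMeasurable
      (hgc'.stronglyMeasurable.prodMk (stronglyMeasurable_deriv x))).measurable).const_mul _
  have hfB : ∀ i t, ‖f i t‖ ≤ ‖(1 / 2 : ℝ)‖ * (C * ‖β i‖ * K * K) := fun i t ↦ by
    rw [hf, norm_mul]
    gcongr
    exact ContinuousLinearMap.le_of_opNorm₂_le_of_le _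
      (ContinuousLinearMap.le_of_opNorm_le_of_le _ (hC' _ (hxm t)) le_rfl) (hd t) (hd t)
  have hPc : ∀ i, Continuous fun t ↦ ∫ s in a..t, f i s := fun i ↦
    (exists_lipschitzWith_integral (a := a) (hfm i) (hfB i)).choose_spec.continuous
  set p : ℝ → E →L[ℝ] ℝ := fun t ↦ ∑ i, (c i + ∫ s in a..t, f i s) • pr i with hp
  have hpc : Continuous p := continuous_finsetSum _ fun i _ ↦
    (continuous_const.add (hPc i)).smul continuous_const
  have hae : ∀ᵐ t, t ∈ Icc a b → g (x t) (deriv x t) = p t := by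
    filter_upwards [ae_all_iff.2 hc] with t ht h't
    rw [hexp (g (x t) (deriv x t))]
    exact Finset.sum_congr rfl fun i _ ↦ by rw [ht i h't]
  -- the velocity
  set v : ℝ → E := fun t ↦ A (x t) (p t) with hv
  have hvc : Continuous v := hAc.clm_apply hpc
  have hgv : ∀ t, g (x t) (v t) = p t := fun t ↦ (hAinv _ (hxm t)).2 (p t)
  have hvae : ∀ᵐ t, t ∈ Icc a b → deriv x t = v t := by
    filter_upwards [hae] with t ht h't
    simp only [hv]
    rw [← ht h't, (hAinv _ (hxm t)).1]
  have haesub : ∀ (q : ℝ → Prop), (∀ᵐ t, t ∈ Icc a b → q t) → ∀ t ∈ Icc a b,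
      ∀ᵐ s, s ∈ uIoc a t → q s := by
    intro q hq t ht
    filter_upwards [hq] with s hs h's
    rw [uIoc_of_le ht.1] at h's
    exact hs ⟨h's.1.le, h's.2.trans ht.2⟩
  -- The `C¹` primitive of the continuous representative `v` of the velocity. It agrees with `x` on
  -- `[a, b]`, so `x` is differentiable everywhere there, one-sidedly at the ends.
  set X : ℝ → E := fun t ↦ x a + ∫ s in a..t, v s with hX
  have hXd : ∀ t, HasDerivAt X (v t) t := fun t ↦
    (hvc.integral_hasStrictDerivAt a t).hasDerivAt.const_add (x a)
  have hxX : ∀ t ∈ Icc a b, x t = X t := by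
    intro t ht
    rw [eq_add_integral_deriv_of_lipschitzWith hx (a := a) (t := t)]
    exact congrArg _ (intervalIntegral.integral_congr_ae (haesub _ hvae t ht))
  have hxd : ∀ t ∈ Icc a b, HasDerivWithinAt x (v t) (Icc a b) t := fun t ht ↦
    (hXd t).hasDerivWithinAt.congr hxX (hxX t ht)
  -- the derivative of the momentum
  set F : ℝ → E →L[ℝ] ℝ := fun t ↦
    ∑ i, ((1 / 2) * fderiv ℝ g (x t) (β i) (v t) (v t)) • pr i with hF
  have hFc : ∀ i, Continuous fun t ↦ (1 / 2) * fderiv ℝ g (x t) (β i) (v t) (v t) := fun i ↦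
    continuous_const.mul
      (((hgc'.clm_apply continuous_const).clm_apply hvc).clm_apply hvc)
  have hFe : ∀ t e, F t e = (1 / 2) * fderiv ℝ g (x t) e (v t) (v t) := by
    intro t e
    have h1 : fderiv ℝ g (x t) e (v t) (v t) =
        ∑ i, pr i e * fderiv ℝ g (x t) (β i) (v t) (v t) := by
      conv_lhs => rw [← β.sum_repr e, map_sum, sum_apply, sum_apply]
      simp [pr, -Module.Basis.sum_repr]
    rw [h1, Finset.mul_sum]
    simp only [hF, sum_apply, smul_apply, smul_eq_mul]
    exact Finset.sum_congr rfl fun i _ ↦ by ring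
  -- The momentum with `deriv x` replaced by `v`: unchanged on `[a, b]`, but its integrands are now
  -- continuous, hence it is differentiable everywhere.
  set Q : ℝ → E →L[ℝ] ℝ := fun t ↦
    ∑ i, (c i + ∫ s in a..t, (1 / 2) * fderiv ℝ g (x s) (β i) (v s) (v s)) • pr i with hQ
  have hQd : ∀ t, HasDerivAt Q (F t) t := fun t ↦ HasDerivAt.fun_sum fun i _ ↦
    (((hFc i).integral_hasStrictDerivAt a t).hasDerivAt.const_add (c i)).smul_const (pr i)
  have hpQ : ∀ t ∈ Icc a b, p t = Q t := by
    intro t ht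
    refine Finset.sum_congr rfl fun i _ ↦ ?_
    congr 2
    refine intervalIntegral.integral_congr_ae ?_
    filter_upwards [haesub _ hvae t ht] with s hs h's
    simp only [hf, hs h's]
  have hpd : ∀ t ∈ Icc a b, HasDerivWithinAt p (F t) (Icc a b) t := fun t ht ↦
    (hQd t).hasDerivWithinAt.congr hpQ (hpQ t ht)
  -- the acceleration
  set w : ℝ → E := fun t ↦ fderiv ℝ A (x t) (v t) (p t) + A (x t) (F t) with hw
  have hFcont : Continuous F := continuous_finsetSum _ fun i _ ↦ (hFc i).smul continuous_const
  have hwc : Continuous w := ((hAc'.clm_apply hvc).clm_apply hpc).add (hAc.clm_apply hFcont)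
  have hvd : ∀ t ∈ Icc a b, HasDerivWithinAt v (w t) (Icc a b) t := fun t ht ↦
    ((hAd _ (hxm t)).comp_hasDerivWithinAt t (hxd t ht)).clm_apply (hpd t ht)
  refine ⟨v, w, hwc, hxd, hvd, fun t ht e ↦ ?_⟩
  -- The identity `g (x) v = p` is differentiated in two ways; uniqueness of the derivative is the
  -- Euler-Lagrange equation.
  have h1 : HasDerivWithinAt (fun t ↦ g (x t) (v t))
      (fderiv ℝ g (x t) (v t) (v t) + g (x t) (w t)) (Icc a b) t :=
    ((hgd _ (hxm t)).comp_hasDerivWithinAt t (hxd t ht)).clm_apply (hvd t ht)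
  have h2 : HasDerivWithinAt (fun t ↦ g (x t) (v t)) (F t) (Icc a b) t := by
    simp only [hgv]
    exact hpd t ht
  have h3 := (uniqueDiffOn_Icc hab t ht).eq_deriv _ h1 h2
  rw [← hFe, ← h3, add_apply, add_comm]

end Variational

/-! ### The metric read in a chart -/

section ChartForm

open Set Filter
open scoped Topology

theorem mdifferentiable_of_mem_maximalAtlas_infty {n : ℕ} {M : Type*} [TopologicalSpace M]
    [ChartedSpace (EuclideanSpace ℝ (Fin n)) M]
    {φ : OpenPartialHomeomorph M (EuclideanSpace ℝ (Fin n))}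
    (hφ : φ ∈ IsManifold.maximalAtlas (𝓡 n) ∞ M) :
    φ.MDifferentiable (𝓡 n) (𝓡 n) :=
  have h1 := IsManifold.maximalAtlas_subset_of_le (I := 𝓡 n) (M := M) (m := 1) (n := ∞)
    (mod_cast le_top) hφ
  ⟨fun _ hx ↦ (mdifferentiableAt_of_mem_maximalAtlas h1 hx).mdifferentiableWithinAt,
    fun _ hx ↦ (mdifferentiableAt_symm_of_mem_maximalAtlas h1 hx).mdifferentiableWithinAt⟩

variable {n : ℕ} {M : Type*} [TopologicalSpace M] [ChartedSpace (EuclideanSpace ℝ (Fin n)) M]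
  [Bundle.RiemannianBundle (fun x : M ↦ TangentSpace (𝓡 n) x)]

/-- The Riemannian metric read in the chart `φ`, as a field of bilinear forms. -/
noncomputable def chartForm (φ : OpenPartialHomeomorph M (EuclideanSpace ℝ (Fin n)))
    (y : EuclideanSpace ℝ (Fin n)) :
    EuclideanSpace ℝ (Fin n) →L[ℝ] EuclideanSpace ℝ (Fin n) →L[ℝ] ℝ :=
  ∑ i, ∑ j, metricMatrix φ y i j •
    (EuclideanSpace.proj (𝕜 := ℝ) i).smulRight (EuclideanSpace.proj (𝕜 := ℝ) j)

variable (φ : OpenPartialHomeomorph M (EuclideanSpace ℝ (Fin n)))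

theorem chartForm_apply (y v w : EuclideanSpace ℝ (Fin n)) :
    chartForm φ y v w = ∑ i, ∑ j, metricMatrix φ y i j * (v i * w j) := by
  simp [chartForm]

theorem euclidean_eq_sum_basisVec (v : EuclideanSpace ℝ (Fin n)) :
    v = ∑ i, v i • basisVec n i := by
  ext j
  simp [basisVec, Pi.single_apply]

theorem chartForm_eq_inner (y v w : EuclideanSpace ℝ (Fin n)) :
    chartForm φ y v w = inner ℝ (mfderiv (𝓡 n) (𝓡 n) φ.symm y v)
      (mfderiv (𝓡 n) (𝓡 n) φ.symm y w) := by
  have key : ∀ v : EuclideanSpace ℝ (Fin n), mfderiv (𝓡 n) (𝓡 n) φ.symm y v =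
      ∑ i, v i • coordVec φ y i := by
    intro v
    conv_lhs => rw [euclidean_eq_sum_basisVec v]
    exact (map_sum _ _ _).trans (Finset.sum_congr rfl fun i _ ↦ map_smul _ _ _)
  rw [chartForm_apply, key, key, sum_inner]
  refine Finset.sum_congr rfl fun i _ ↦ ?_
  rw [inner_sum]
  refine Finset.sum_congr rfl fun j _ ↦ ?_
  rw [inner_smul_left, inner_smul_right]
  simp only [metricMatrix, Matrix.of_apply, conj_trivial]
  ring

theorem chartForm_symm (y v w : EuclideanSpace ℝ (Fin n)) :
    chartForm φ y v w = chartForm φ y w v := by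
  rw [chartForm_eq_inner, chartForm_eq_inner, real_inner_comm]

theorem chartForm_self (y v : EuclideanSpace ℝ (Fin n)) :
    chartForm φ y v v = ‖mfderiv (𝓡 n) (𝓡 n) φ.symm y v‖ ^ 2 := by
  rw [chartForm_eq_inner, real_inner_self_eq_norm_sq]

variable {φ} [IsManifold (𝓡 n) ∞ M]

theorem chartForm_pos (hφ : φ ∈ IsManifold.maximalAtlas (𝓡 n) ∞ M)
    {y : EuclideanSpace ℝ (Fin n)} (hy : y ∈ φ.target) {v : EuclideanSpace ℝ (Fin n)}
    (hv : v ≠ 0) : 0 < chartForm φ y v v := by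
  have : IsManifold (𝓡 n) 1 M := .of_le (n := ∞) (mod_cast le_top)
  rw [chartForm_self]
  have hinj := (mdifferentiable_of_mem_maximalAtlas_infty hφ).symm.mfderiv_injective
    (show y ∈ φ.symm.source from hy)
  have hne : mfderiv (𝓡 n) (𝓡 n) φ.symm y v ≠ 0 := fun h ↦ hv (hinj (h.trans (map_zero _).symm))
  positivity

variable [IsContMDiffRiemannianBundle (𝓡 n) ∞ (EuclideanSpace ℝ (Fin n))
      (fun x : M ↦ TangentSpace (𝓡 n) x)]

/-- The coordinate fields are the images of constant fields under the tangent map of `φ.symm`, hence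
`C¹` sections, and the metric pairs `C¹` sections into `C¹` functions. -/
theorem contDiffOn_metricMatrix (hφ : φ ∈ IsManifold.maximalAtlas (𝓡 n) ∞ M) (i j : Fin n) :
    ContDiffOn ℝ 1 (fun y ↦ metricMatrix φ y i j) φ.target := by
  have : IsManifold (𝓡 n) 1 M := .of_le (n := ∞) (mod_cast le_top)
  have hs : ContMDiffOn (𝓡 n) (𝓡 n) ∞ φ.symm φ.target :=
    contMDiffOn_symm_of_mem_maximalAtlas hφ
  have ht := hs.contMDiffOn_tangentMapWithin (m := 1) (by norm_cast)
    φ.open_target.uniqueMDiffOn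
  have hb : ∀ i, ContMDiffOn (𝓡 n) (𝓡 n).tangent 1
      (fun y ↦ (⟨φ.symm y, coordVec φ y i⟩ : TangentBundle (𝓡 n) M)) φ.target := by
    intro i
    have hc : ContMDiff (𝓡 n) (𝓡 n).tangent 1 (fun y : EuclideanSpace ℝ (Fin n) ↦
        (⟨y, basisVec n i⟩ : TangentBundle (𝓡 n) (EuclideanSpace ℝ (Fin n)))) :=
      contMDiff_vectorSpace_iff_contDiff.2 contDiff_const
    refine (ht.comp hc.contMDiffOn (fun y hy ↦ hy)).congr fun y hy ↦ ?_
    simp only [Function.comp_apply, tangentMapWithin, coordVec]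
    rw [mfderivWithin_of_isOpen φ.open_target hy]
  rw [← contMDiffOn_iff_contDiffOn]
  exact ContMDiffOn.inner_bundle (hb i) (hb j)

theorem contDiffOn_chartForm (hφ : φ ∈ IsManifold.maximalAtlas (𝓡 n) ∞ M) :
    ContDiffOn ℝ 1 (chartForm φ) φ.target := by
  refine ContDiffOn.sum fun i _ ↦ ContDiffOn.sum fun j _ ↦ ?_
  exact (contDiffOn_metricMatrix hφ i j).smul contDiffOn_const

theorem fderiv_chartForm_apply (hφ : φ ∈ IsManifold.maximalAtlas (𝓡 n) ∞ M)
    {y : EuclideanSpace ℝ (Fin n)} (hy : y ∈ φ.target) (e v w : EuclideanSpace ℝ (Fin n)) :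
    fderiv ℝ (chartForm φ) y e v w =
      ∑ k, ∑ i, ∑ j, metricPartial φ y k i j * (e k * v i * w j) := by
  have hd : ∀ i j, HasFDerivAt (fun y ↦ metricMatrix φ y i j)
      (fderiv ℝ (fun y ↦ metricMatrix φ y i j) y) y := fun i j ↦
    (((contDiffOn_metricMatrix hφ i j).contDiffAt
      (φ.open_target.mem_nhds hy)).differentiableAt one_ne_zero).hasFDerivAt
  have h1 : HasFDerivAt (chartForm φ) (∑ i, ∑ j,
      (fderiv ℝ (fun y ↦ metricMatrix φ y i j) y).smulRight
        ((EuclideanSpace.proj (𝕜 := ℝ) i).smulRight (EuclideanSpace.proj (𝕜 := ℝ) j))) y :=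
    HasFDerivAt.fun_sum fun i _ ↦ HasFDerivAt.fun_sum fun j _ ↦ (hd i j).smul_const _
  have h2 : ∀ i j, fderiv ℝ (fun y ↦ metricMatrix φ y i j) y e =
      ∑ k, e k * metricPartial φ y k i j := by
    intro i j
    conv_lhs => rw [euclidean_eq_sum_basisVec e, map_sum]
    simp [metricPartial]
  rw [h1.fderiv]
  simp only [sum_apply, ContinuousLinearMap.smulRight_apply, smul_apply, h2,
    smul_eq_mul, Finset.sum_mul, PiLp.proj_apply]
  rw [Finset.sum_comm_cycle]
  refine Finset.sum_congr rfl fun k _ ↦ ?_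
  refine Finset.sum_congr rfl fun i _ ↦ ?_
  refine Finset.sum_congr rfl fun j _ ↦ ?_
  ring

end ChartForm

/-! ### Positive definite forms -/

section PositiveForms

open Set Filter
open scoped Topology

variable {E : Type*} [NormedAddCommGroup E] [NormedSpace ℝ E]

/-- The Cauchy-Schwarz inequality for a positive definite bilinear form. -/
theorem abs_form_le_sqrt_mul_sqrt {B : E →L[ℝ] E →L[ℝ] ℝ} (hsymm : ∀ v w, B v w = B w v)
    (hB : ∀ v, v ≠ 0 → 0 < B v v) (v w : E) : |B v w| ≤ √(B v v) * √(B w w) := by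
  have hnn : ∀ u, 0 ≤ B u u := fun u ↦ by
    rcases eq_or_ne u 0 with rfl | hu
    · simp
    · exact (hB u hu).le
  -- The quadratic polynomial `t ↦ B (v + t w) (v + t w)` is nonnegative, so its discriminant is not
  -- positive.
  have h : ∀ t : ℝ, 0 ≤ B w w * (t * t) + (2 * B v w) * t + B v v := by
    intro t
    have := hnn (v + t • w)
    simp only [map_add, map_smul, add_apply, smul_apply, smul_eq_mul, hsymm w v] at this
    linarith
  have hd := discrim_le_zero h
  rw [discrim] at hd
  rw [← Real.sqrt_mul (hnn v)]
  exact Real.abs_le_sqrt (by nlinarith)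

variable [FiniteDimensional ℝ E]

theorem exists_pos_mul_norm_sq_le {B : E →L[ℝ] E →L[ℝ] ℝ} (hB : ∀ v, v ≠ 0 → 0 < B v v) :
    ∃ c > 0, ∀ v, c * ‖v‖ ^ 2 ≤ B v v := by
  rcases subsingleton_or_nontrivial E with hE | hE
  · exact ⟨1, one_pos, fun v ↦ by simp [Subsingleton.elim v 0]⟩
  have hc : ContinuousOn (fun v ↦ B v v) (Metric.sphere (0 : E) 1) := by fun_prop
  obtain ⟨u, hu, hmin⟩ := (isCompact_sphere (0 : E) 1).exists_isMinOn
    (NormedSpace.sphere_nonempty.2 zero_le_one) hc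
  have hu0 : u ≠ 0 := by
    rintro rfl
    simp at hu
  refine ⟨B u u, hB u hu0, fun v ↦ ?_⟩
  rcases eq_or_ne v 0 with rfl | hv
  · simp
  have hv' : ‖v‖ ≠ 0 := norm_ne_zero_iff.2 hv
  have h1 : B u u ≤ B (‖v‖⁻¹ • v) (‖v‖⁻¹ • v) := hmin (by simp [norm_smul, hv'])
  simp only [map_smul, smul_apply, smul_eq_mul] at h1
  calc B u u * ‖v‖ ^ 2 ≤ (‖v‖⁻¹ * (‖v‖⁻¹ * B v v)) * ‖v‖ ^ 2 := by gcongr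
    _ = B v v := by field_simp

/-- Coercivity of `g z` turns closeness in operator norm into closeness relative to `g z v v`,
uniformly in `v`. -/
theorem eventually_sqrt_form_le {g : E → E →L[ℝ] E →L[ℝ] ℝ} {z : E} (hg : ContinuousAt g z)
    (hz : ∀ v, v ≠ 0 → 0 < g z v v) {ε : ℝ} (hε : 0 < ε) :
    ∀ᶠ y in 𝓝 z, ∀ v, √(g y v v) ≤ (1 + ε) * √(g z v v) ∧ √(g z v v) ≤ (1 + ε) * √(g y v v) := by
  obtain ⟨c, hc, hcz⟩ := exists_pos_mul_norm_sq_le hz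
  -- The relative error `ε / (1 + ε)` is chosen because `1 - ε / (1 + ε) = (1 + ε)⁻¹`, which serves
  -- the reverse comparison.
  have hθ : 0 < c * (ε / (1 + ε)) := by positivity
  filter_upwards [Metric.continuousAt_iff'.1 hg _ hθ] with y hy v
  rw [dist_eq_norm] at hy
  have h1 : |g y v v - g z v v| ≤ (ε / (1 + ε)) * g z v v := by
    have h2 : ‖(g y - g z) v v‖ ≤ c * (ε / (1 + ε)) * ‖v‖ * ‖v‖ :=
      ContinuousLinearMap.le_of_opNorm₂_le_of_le _ hy.le le_rfl le_rfl
    rw [sub_apply, sub_apply, Real.norm_eq_abs] at h2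
    refine h2.trans ?_
    calc c * (ε / (1 + ε)) * ‖v‖ * ‖v‖ = (ε / (1 + ε)) * (c * ‖v‖ ^ 2) := by ring
      _ ≤ _ := by gcongr; exact hcz v
  have hz0 : 0 ≤ g z v v := le_trans (by positivity) (hcz v)
  have hθ1 : ε / (1 + ε) ≤ ε := div_le_self hε.le (by linarith)
  obtain ⟨h3, h4⟩ := abs_le.1 h1
  have h5 : g y v v ≤ (1 + ε) ^ 2 * g z v v := by nlinarith [mul_le_mul_of_nonneg_right hθ1 hz0]
  have h6 : g z v v ≤ (1 + ε) * g y v v := by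
    have h7 : g z v v * (1 - ε / (1 + ε)) ≤ g y v v := by linarith
    have h8 : 1 - ε / (1 + ε) = (1 + ε)⁻¹ := by field_simp; ring
    rw [h8, ← div_eq_mul_inv, div_le_iff₀ (by linarith)] at h7
    linarith
  have hy0 : 0 ≤ g y v v := by
    by_contra hneg
    push Not at hneg
    nlinarith
  have h9 : g z v v ≤ (1 + ε) ^ 2 * g y v v := by nlinarith
  constructor
  · calc √(g y v v) ≤ √((1 + ε) ^ 2 * g z v v) := Real.sqrt_le_sqrt h5
      _ = (1 + ε) * √(g z v v) := by
        rw [Real.sqrt_mul (by positivity), Real.sqrt_sq (by linarith)]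
  · calc √(g z v v) ≤ √((1 + ε) ^ 2 * g y v v) := Real.sqrt_le_sqrt h9
      _ = (1 + ε) * √(g y v v) := by
        rw [Real.sqrt_mul (by positivity), Real.sqrt_sq (by linarith)]

end PositiveForms

/-! ### The length integrand in a chart -/

section Distance

open Set Filter MeasureTheory
open scoped Topology

variable {n : ℕ} {M : Type*} [TopologicalSpace M] [ChartedSpace (EuclideanSpace ℝ (Fin n)) M]
  [Bundle.RiemannianBundle (fun x : M ↦ TangentSpace (𝓡 n) x)]
  {φ : OpenPartialHomeomorph M (EuclideanSpace ℝ (Fin n))}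

theorem enorm_mfderiv_eq_sqrt_chartForm (hφ : φ ∈ IsManifold.maximalAtlas (𝓡 n) ∞ M)
    {c : ℝ → M} {x : ℝ → EuclideanSpace ℝ (Fin n)} {v : EuclideanSpace ℝ (Fin n)} {t : ℝ}
    (hx : HasDerivAt x v t) (hxt : x t ∈ φ.target) (hc : c =ᶠ[𝓝 t] φ.symm ∘ x) :
    ‖mfderiv 𝓘(ℝ, ℝ) (𝓡 n) c t 1‖ₑ = ENNReal.ofReal (√(chartForm φ (x t) v v)) := by
  have A : c t = (φ.symm ∘ x) t := hc.eq_of_nhds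
  have h1 : ‖mfderiv 𝓘(ℝ, ℝ) (𝓡 n) c t 1‖ₑ = ‖mfderiv 𝓘(ℝ, ℝ) (𝓡 n) (φ.symm ∘ x) t 1‖ₑ := by
    -- The tangent spaces at `c t` and at `φ.symm (x t)` carry norms indexed by different
    -- expressions of the base point; the norm is transported along their equality.
    have key : ∀ {a b : M} (_ : a = b) (v : EuclideanSpace ℝ (Fin n)),
        ‖(id v : TangentSpace (𝓡 n) a)‖ₑ = ‖(id v : TangentSpace (𝓡 n) b)‖ₑ := by
      rintro a _ rfl v; rfl
    have heq : mfderiv 𝓘(ℝ, ℝ) (𝓡 n) c t = mfderiv 𝓘(ℝ, ℝ) (𝓡 n) (φ.symm ∘ x) t :=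
      Filter.EventuallyEq.mfderiv_eq hc
    exact (congrArg (fun L : ℝ →L[ℝ] EuclideanSpace ℝ (Fin n) ↦
      ‖(id (L 1) : TangentSpace (𝓡 n) (c t))‖ₑ) heq).trans (key A _)
  have hs : MDifferentiableAt (𝓡 n) (𝓡 n) φ.symm (x t) :=
    (mdifferentiable_of_mem_maximalAtlas_infty hφ).mdifferentiableAt_symm hxt
  have h2 : mfderiv 𝓘(ℝ, ℝ) (𝓡 n) (φ.symm ∘ x) t =
      (mfderiv (𝓡 n) (𝓡 n) φ.symm (x t)).comp (mfderiv 𝓘(ℝ, ℝ) (𝓡 n) x t) :=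
    mfderiv_comp (I := 𝓘(ℝ, ℝ)) (I' := 𝓡 n) (I'' := 𝓡 n) t hs hx.differentiableAt.mdifferentiableAt
  have h3 : mfderiv 𝓘(ℝ, ℝ) (𝓡 n) (φ.symm ∘ x) t 1 = mfderiv (𝓡 n) (𝓡 n) φ.symm (x t) v := by
    rw [h2]
    have h4 : mfderiv 𝓘(ℝ, ℝ) (𝓡 n) x t 1 = v := by
      rw [mfderiv_eq_fderiv]
      exact hx.deriv
    exact congrArg _ h4
  rw [h1, h3, chartForm_self, Real.sqrt_sq (norm_nonneg _), ofReal_norm]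

end Distance

/-! ### Comparing the distance with the metric in a chart -/

section Distance

open Set Filter MeasureTheory Manifold
open scoped Topology

theorem eventuallyEq_symm_comp {X M : Type*} [TopologicalSpace X] [TopologicalSpace M]
    {φ : OpenPartialHomeomorph M X} {c : ℝ → M} {t : ℝ} (hc : ContinuousAt c t)
    (ht : c t ∈ φ.source) : c =ᶠ[𝓝 t] φ.symm ∘ fun τ ↦ φ (c τ) := by
  filter_upwards [hc (φ.open_source.mem_nhds ht)] with τ hτ
  exact (φ.left_inv hτ).symm

variable {n : ℕ} {M : Type*} [EMetricSpace M] [ChartedSpace (EuclideanSpace ℝ (Fin n)) M]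
  {φ : OpenPartialHomeomorph M (EuclideanSpace ℝ (Fin n))}

theorem contDiffAt_chart_comp (hφ : φ ∈ IsManifold.maximalAtlas (𝓡 n) ∞ M) {c : ℝ → M} {t : ℝ}
    (hc : ContMDiffAt 𝓘(ℝ, ℝ) (𝓡 n) 1 c t) (ht : c t ∈ φ.source) :
    ContDiffAt ℝ 1 (fun τ ↦ φ (c τ)) t := by
  rw [← contMDiffAt_iff_contDiffAt]
  exact ((contMDiffAt_of_mem_maximalAtlas hφ ht).of_le (mod_cast le_top)).comp t hc

variable [Bundle.RiemannianBundle (fun x : M ↦ TangentSpace (𝓡 n) x)]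

theorem edist_le_pathELength [IsRiemannianManifold (𝓡 n) M] {c : ℝ → M}
    (hc : ContMDiff 𝓘(ℝ, ℝ) (𝓡 n) 1 c) {s t : ℝ}
    (hst : s ≤ t) : edist (c s) (c t) ≤ pathELength (𝓡 n) c s t := by
  rw [IsRiemannianManifold.out (I := 𝓡 n)]
  exact riemannianEDist_le_pathELength hc.contMDiffOn rfl rfl hst

/-- The coordinate segment from `u` to `v` is an admissible curve; its speed is bounded by `C`. -/
theorem edist_symm_le_of_convex [IsRiemannianManifold (𝓡 n) M]
    (hφ : φ ∈ IsManifold.maximalAtlas (𝓡 n) ∞ M)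
    {W : Set (EuclideanSpace ℝ (Fin n))} (hW : Convex ℝ W) (hWt : W ⊆ φ.target) {C : ℝ}
    {u v : EuclideanSpace ℝ (Fin n)} (hu : u ∈ W) (hv : v ∈ W)
    (h : ∀ y ∈ W, √(chartForm φ y (v - u) (v - u)) ≤ C) :
    edist (φ.symm u) (φ.symm v) ≤ ENNReal.ofReal C := by
  set x : ℝ → EuclideanSpace ℝ (Fin n) := fun t ↦ u + t • (v - u) with hx
  have hxW : ∀ t ∈ Icc (0 : ℝ) 1, x t ∈ W := fun t ht ↦ by
    simp only [hx]
    rw [show u + t • (v - u) = (1 - t) • u + t • v by module]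
    exact hW hu hv (by linarith [ht.2]) ht.1 (by ring)
  have hxd : ∀ t, HasDerivAt x (v - u) t := fun t ↦ by
    simpa [hx] using! ((hasDerivAt_id t).smul_const (v - u)).const_add u
  have hxs : ContMDiff 𝓘(ℝ, ℝ) (𝓡 n) 1 x := by
    rw [contMDiff_iff_contDiff]
    exact contDiff_const.add (contDiff_id.smul contDiff_const)
  have hγ : ContMDiffOn 𝓘(ℝ, ℝ) (𝓡 n) 1 (φ.symm ∘ x) (Icc 0 1) :=
    ((contMDiffOn_symm_of_mem_maximalAtlas hφ).of_le (mod_cast le_top)).comp hxs.contMDiffOn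
      fun t ht ↦ hWt (hxW t ht)
  rw [IsRiemannianManifold.out (I := 𝓡 n)]
  refine (riemannianEDist_le_pathELength hγ (by simp [hx]) (by simp [hx]) zero_le_one).trans ?_
  rw [pathELength_eq_lintegral_mfderiv_Ioo]
  calc ∫⁻ t in Ioo (0 : ℝ) 1, ‖mfderiv 𝓘(ℝ, ℝ) (𝓡 n) (φ.symm ∘ x) t 1‖ₑ
      ≤ ∫⁻ _ in Ioo (0 : ℝ) 1, ENNReal.ofReal C := by
        refine setLIntegral_mono' measurableSet_Ioo fun t ht ↦ ?_
        have h't := hxW t (Ioo_subset_Icc_self ht)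
        rw [enorm_mfderiv_eq_sqrt_chartForm hφ (hxd t) (hWt h't) (.refl _ _)]
        exact ENNReal.ofReal_le_ofReal (h _ h't)
    _ = ENNReal.ofReal C := by simp

variable [IsManifold (𝓡 n) ∞ M]

/-- A calibration argument: the functional `ℓ = s⁻¹ g_z(h, ·)` takes the value `s = |h|_z` at the
displacement `h`, and by Cauchy-Schwarz `|ℓ w| ≤ |w|_z`. Integrating the derivative of `ℓ ∘ φ ∘ c`
bounds the length from below. -/
theorem sqrt_chartForm_le_pathELength (hφ : φ ∈ IsManifold.maximalAtlas (𝓡 n) ∞ M)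
    {z : EuclideanSpace ℝ (Fin n)} (hz : z ∈ φ.target)
    {W : Set (EuclideanSpace ℝ (Fin n))} {C : ℝ} (hC : 0 ≤ C)
    (hW : ∀ y ∈ W, ∀ v, √(chartForm φ z v v) ≤ C * √(chartForm φ y v v))
    {c : ℝ → M} (hc : ContMDiff 𝓘(ℝ, ℝ) (𝓡 n) 1 c)
    (hcW : ∀ t ∈ Icc (0 : ℝ) 1, c t ∈ φ.source ∧ φ (c t) ∈ W) :
    ENNReal.ofReal √(chartForm φ z (φ (c 1) - φ (c 0)) (φ (c 1) - φ (c 0))) ≤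
      ENNReal.ofReal C * pathELength (𝓡 n) c 0 1 := by
  set h := φ (c 1) - φ (c 0) with hh
  rcases eq_or_ne h 0 with h0 | h0
  · simp [h0]
  have hpos : 0 < chartForm φ z h h := chartForm_pos hφ hz h0
  set s := √(chartForm φ z h h) with hs
  have hs0 : 0 < s := Real.sqrt_pos.2 hpos
  set ℓ : EuclideanSpace ℝ (Fin n) →L[ℝ] ℝ := s⁻¹ • chartForm φ z h with hℓ
  have hℓh : ℓ h = s := by
    have : s * s = chartForm φ z h h := Real.mul_self_sqrt hpos.le
    simp only [hℓ, smul_apply, smul_eq_mul, ← this]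
    field_simp
  have hℓw : ∀ w, |ℓ w| ≤ √(chartForm φ z w w) := fun w ↦ by
    have := abs_form_le_sqrt_mul_sqrt (chartForm_symm φ z) (fun v hv ↦ chartForm_pos hφ hz hv) h w
    rw [hℓ, smul_apply, smul_eq_mul, abs_mul, abs_of_pos (inv_pos.2 hs0), inv_mul_le_iff₀ hs0]
    exact this
  have hx : ∀ t ∈ Icc (0 : ℝ) 1, ContDiffAt ℝ 1 (fun τ ↦ φ (c τ)) t := fun t ht ↦
    contDiffAt_chart_comp hφ hc.contMDiffAt (hcW t ht).1
  have hf : ∀ t ∈ Icc (0 : ℝ) 1, HasDerivAt (fun τ ↦ ℓ (φ (c τ)))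
      (ℓ (deriv (fun τ ↦ φ (c τ)) t)) t := fun t ht ↦
    ℓ.hasFDerivAt.comp_hasDerivAt t ((hx t ht).differentiableAt one_ne_zero).hasDerivAt
  have hfs : ContDiffOn ℝ 1 (fun τ ↦ ℓ (φ (c τ))) (Icc 0 1) := fun t ht ↦
    (ℓ.contDiff.contDiffAt.comp t (hx t ht)).contDiffWithinAt
  have key := enorm_sub_le_lintegral_derivWithin_Icc_of_contDiffOn_Icc hfs zero_le_one
  rw [← map_sub, ← hh, hℓh, Real.enorm_of_nonneg hs0.le] at key
  refine key.trans ?_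
  rw [pathELength_eq_lintegral_mfderiv_Icc, ← lintegral_const_mul' _ _ ENNReal.ofReal_ne_top]
  refine setLIntegral_mono' measurableSet_Icc fun t ht ↦ ?_
  rw [(hf t ht).hasDerivWithinAt.derivWithin (uniqueDiffOn_Icc zero_lt_one t ht),
    enorm_mfderiv_eq_sqrt_chartForm hφ ((hx t ht).differentiableAt one_ne_zero).hasDerivAt
      (φ.map_source (hcW t ht).1) (eventuallyEq_symm_comp hc.continuous.continuousAt (hcW t ht).1),
    ← ENNReal.ofReal_mul hC, Real.enorm_eq_ofReal_abs]
  exact ENNReal.ofReal_le_ofReal ((hℓw _).trans (hW _ (hcW t ht).2 _))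

variable [IsContMDiffRiemannianBundle (𝓡 n) ∞ (EuclideanSpace ℝ (Fin n))
  (fun x : M ↦ TangentSpace (𝓡 n) x)] [IsRiemannianManifold (𝓡 n) M]

/-- In a chart, the Riemannian distance is infinitesimally given by the metric. -/
theorem exists_ball_edist_symm_bounds (hφ : φ ∈ IsManifold.maximalAtlas (𝓡 n) ∞ M)
    {z : EuclideanSpace ℝ (Fin n)} (hz : z ∈ φ.target) {ε : ℝ} (hε : 0 < ε) :
    ∃ r > 0, Metric.ball z r ⊆ φ.target ∧ ∀ u ∈ Metric.ball z r, ∀ v ∈ Metric.ball z r,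
      edist (φ.symm u) (φ.symm v) ≤
        ENNReal.ofReal ((1 + ε) * √(chartForm φ z (v - u) (v - u))) ∧
      ENNReal.ofReal √(chartForm φ z (v - u) (v - u)) ≤
        ENNReal.ofReal (1 + ε) * edist (φ.symm u) (φ.symm v) := by
  have hcont : ContinuousAt (chartForm φ) z :=
    (contDiffOn_chartForm hφ).continuousOn.continuousAt (φ.open_target.mem_nhds hz)
  obtain ⟨r₀, hr₀, hball⟩ := Metric.mem_nhds_iff.1 (Filter.inter_mem (φ.open_target.mem_nhds hz)
    (eventually_sqrt_form_le hcont (fun v hv ↦ chartForm_pos hφ hz hv) hε))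
  have hsym : ContinuousAt φ.symm z := φ.continuousAt_symm hz
  have hzs : φ.symm z ∈ φ.source := φ.map_target hz
  have hpre : φ.source ∩ φ ⁻¹' (Metric.ball z r₀) ∈ 𝓝 (φ.symm z) := by
    refine Filter.inter_mem (φ.open_source.mem_nhds hzs) ((φ.continuousAt hzs) ?_)
    rw [φ.right_inv hz]
    exact Metric.ball_mem_nhds z hr₀
  -- A curve of length below `δ / 2` starting within `δ / 4` of `φ.symm z` cannot leave the chart
  -- region where the forms are comparable. Nearly optimal curves between nearby points are of this
  -- kind.
  obtain ⟨δ, hδ, hδW⟩ := EMetric.mem_nhds_iff.1 hpre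
  have hδ4 : 0 < δ / 4 := ENNReal.div_pos hδ.ne' (by simp)
  obtain ⟨r, hr, hr'⟩ := Metric.mem_nhds_iff.1 (hsym (Metric.eball_mem_nhds _ hδ4))
  refine ⟨min r₀ r, lt_min hr₀ hr, fun y hy ↦
    (hball (Metric.ball_subset_ball (min_le_left _ _) hy)).1, fun u hu v hv ↦ ⟨?_, ?_⟩⟩
  · exact edist_symm_le_of_convex hφ (convex_ball z r₀) (fun y hy ↦ (hball hy).1)
      (Metric.ball_subset_ball (min_le_left _ _) hu)
      (Metric.ball_subset_ball (min_le_left _ _) hv) fun y hy ↦ ((hball hy).2 _).1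
  · have hu1 := (hball (Metric.ball_subset_ball (min_le_left _ _) hu)).1
    have hv1 := (hball (Metric.ball_subset_ball (min_le_left _ _) hv)).1
    have hu2 : edist (φ.symm u) (φ.symm z) < δ / 4 :=
      hr' (Metric.ball_subset_ball (min_le_right _ _) hu)
    have hv2 : edist (φ.symm v) (φ.symm z) < δ / 4 :=
      hr' (Metric.ball_subset_ball (min_le_right _ _) hv)
    have h44 : δ / 4 + δ / 4 = δ / 2 := by
      rw [ENNReal.div_add_div_same, ← two_mul, show (4 : ℝ≥0∞) = 2 * 2 by norm_num,
        ENNReal.mul_div_mul_left _ _ (by simp) (by simp)]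
    have hduv : edist (φ.symm u) (φ.symm v) < δ / 2 := by
      rw [← h44]
      refine (edist_triangle_right _ _ (φ.symm z)).trans_lt (ENNReal.add_lt_add hu2 hv2)
    rw [mul_comm, ← ENNReal.div_le_iff_le_mul (Or.inl (by simp; linarith)) (Or.inl (by simp))]
    refine le_of_forall_gt_imp_ge_of_dense fun η hη ↦ ?_
    rw [ENNReal.div_le_iff_le_mul (Or.inl (by simp; linarith)) (Or.inl (by simp)), mul_comm]
    have hlt : riemannianEDist (𝓡 n) (φ.symm u) (φ.symm v) < min η (δ / 2) := by
      rw [← IsRiemannianManifold.out]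
      exact lt_min hη hduv
    obtain ⟨c, hc0, hc1, hc, hlen, -, -⟩ :=
      exists_lt_locally_constant_of_riemannianEDist_lt hlt zero_lt_one
    have hcW : ∀ t ∈ Icc (0 : ℝ) 1, c t ∈ φ.source ∧ φ (c t) ∈ Metric.ball z r₀ := by
      intro t ht
      refine hδW ?_
      have h1 : edist (c 0) (c t) < δ / 2 :=
        ((edist_le_pathELength hc ht.1).trans (pathELength_mono le_rfl ht.2)).trans_lt
          (hlen.trans_le (min_le_right _ _))
      rw [Metric.mem_eball]
      calc edist (c t) (φ.symm z) ≤ edist (c t) (φ.symm u) + edist (φ.symm u) (φ.symm z) :=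
            edist_triangle _ _ _
        _ < δ / 2 + δ / 4 := by
            refine ENNReal.add_lt_add ?_ hu2
            rwa [edist_comm, ← hc0]
        _ ≤ δ / 2 + δ / 2 := by
            refine add_le_add_right ?_ _
            rw [← h44]
            exact le_self_add
        _ = δ := ENNReal.add_halves δ
    have := sqrt_chartForm_le_pathELength hφ hz (C := 1 + ε) (by linarith)
      (fun y hy v ↦ ((hball hy).2 v).2) hc hcW
    rw [hc0, hc1, φ.right_inv hu1, φ.right_inv hv1] at this
    exact this.trans (by gcongr; exact hlen.le.trans (min_le_left _ _))

end Distance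

/-! ### Existence of metric geodesics -/

section MetricGeodesic

open Set Filter MeasureTheory Manifold
open scoped Topology

variable {n : ℕ} {M : Type*} [EMetricSpace M] [ChartedSpace (EuclideanSpace ℝ (Fin n)) M]
  [Bundle.RiemannianBundle (fun x : M ↦ TangentSpace (𝓡 n) x)]

/-- Of the total length `L + ε`, the part before `u` uses at least `s * L` and the part after `v` at
least `L - t * L`, so at most `(t - s) * L + ε` remains between them. -/
theorem edist_le_of_pathELength_le [IsRiemannianManifold (𝓡 n) M] {c : ℝ → M}
    (hc : ContMDiff 𝓘(ℝ, ℝ) (𝓡 n) 1 c) {L ε : ℝ}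
    (hL : 0 ≤ L) (hε : 0 ≤ ε) (hdist : edist (c 0) (c 1) = ENNReal.ofReal L)
    (hlen : pathELength (𝓡 n) c 0 1 ≤ ENNReal.ofReal (L + ε)) {s t u v : ℝ}
    (hs : s ∈ Icc (0 : ℝ) 1) (ht : t ∈ Icc (0 : ℝ) 1) (hu : 0 ≤ u) (huv : u ≤ v) (hv : v ≤ 1)
    (hsu : edist (c 0) (c u) = ENNReal.ofReal (s * L))
    (htv : edist (c 0) (c v) = ENNReal.ofReal (t * L)) :
    edist (c u) (c v) ≤ ENNReal.ofReal (L * |s - t| + ε) := by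
  have h1 : ENNReal.ofReal (s * L) ≤ pathELength (𝓡 n) c 0 u := hsu ▸ edist_le_pathELength hc hu
  have h2 : ENNReal.ofReal (L - t * L) ≤ pathELength (𝓡 n) c v 1 := by
    rw [ENNReal.ofReal_sub _ (mul_nonneg ht.1 hL), tsub_le_iff_left, ← htv, ← hdist]
    exact (edist_triangle _ (c v) _).trans (add_le_add_right (edist_le_pathELength hc hv) _)
  have h3 := edist_le_pathELength (n := n) hc huv
  have htot : ENNReal.ofReal (s * L) + edist (c u) (c v) + ENNReal.ofReal (L - t * L) ≤
      ENNReal.ofReal (L + ε) := by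
    refine le_trans ?_ hlen
    rw [← pathELength_add (hu.trans huv) hv, ← pathELength_add hu huv]
    gcongr
  have hfin : edist (c u) (c v) ≠ ⊤ := fun h ↦ by simp [h] at htot
  rw [← ENNReal.ofReal_toReal hfin] at htot ⊢
  have hb : 0 ≤ L - t * L := by nlinarith [ht.2]
  rw [← ENNReal.ofReal_add (mul_nonneg hs.1 hL) ENNReal.toReal_nonneg,
    ← ENNReal.ofReal_add (add_nonneg (mul_nonneg hs.1 hL) ENNReal.toReal_nonneg) hb,
    ENNReal.ofReal_le_ofReal_iff (by linarith)] at htot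
  refine ENNReal.ofReal_le_ofReal ?_
  have := mul_le_mul_of_nonneg_left (neg_abs_le (s - t)) hL
  linarith

/-- A nearly minimizing curve is reparametrized by distance from `p`, using the intermediate value
theorem. The choice need not be continuous: only the estimates survive in the limit. -/
theorem exists_almost_geodesic [IsRiemannianManifold (𝓡 n) M] {p q : M} {L ε : ℝ}
    (hL : 0 ≤ L) (hε : 0 < ε)
    (hpq : edist p q = ENNReal.ofReal L) :
    ∃ γ : ℝ → M, γ 1 = q ∧ (∀ s ∈ Icc (0 : ℝ) 1, edist p (γ s) = ENNReal.ofReal (s * L)) ∧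
      ∀ s ∈ Icc (0 : ℝ) 1, ∀ t ∈ Icc (0 : ℝ) 1,
        edist (γ s) (γ t) ≤ ENNReal.ofReal (L * |s - t| + ε) := by
  have hlt : riemannianEDist (𝓡 n) p q < ENNReal.ofReal (L + ε) := by
    rw [← IsRiemannianManifold.out, hpq]
    exact (ENNReal.ofReal_lt_ofReal_iff (by linarith)).2 (by linarith)
  obtain ⟨c, rfl, rfl, hc, hlen, -, -⟩ :=
    exists_lt_locally_constant_of_riemannianEDist_lt hlt zero_lt_one
  have hfin : ∀ u ∈ Icc (0 : ℝ) 1, edist (c 0) (c u) ≠ ⊤ := fun u hu ↦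
    (((edist_le_pathELength hc hu.1).trans (pathELength_mono le_rfl hu.2)).trans_lt
      (hlen.trans ENNReal.ofReal_lt_top)).ne
  have hcont : ContinuousOn (fun u ↦ (edist (c 0) (c u)).toReal) (Icc 0 1) :=
    ENNReal.continuousOn_toReal.comp (continuous_const.edist hc.continuous).continuousOn hfin
  -- The curve may reach distance `L` before its end, so the parameter `1` is imposed at `s = 1` to
  -- land on `q`.
  have hex : ∀ s ∈ Icc (0 : ℝ) 1, ∃ u ∈ Icc (0 : ℝ) 1,
      edist (c 0) (c u) = ENNReal.ofReal (s * L) ∧ (s = 1 → u = 1) := by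
    intro s hs
    rcases eq_or_ne s 1 with rfl | hs1
    · exact ⟨1, by simp, by rw [one_mul, hpq], fun _ ↦ rfl⟩
    · have := intermediate_value_Icc zero_le_one hcont
      simp only [edist_self, ENNReal.toReal_zero, hpq, ENNReal.toReal_ofReal hL] at this
      obtain ⟨u, hu, h⟩ := this ⟨mul_nonneg hs.1 hL, mul_le_of_le_one_left hL hs.2⟩
      exact ⟨u, hu, by rw [← h, ENNReal.ofReal_toReal (hfin u hu)], fun h ↦ absurd h hs1⟩
  choose! U hU hUd hU1 using hex
  refine ⟨c ∘ U, by simp [hU1], hUd, fun s hs t ht ↦ ?_⟩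
  rcases le_total (U s) (U t) with h | h
  · exact edist_le_of_pathELength_le hc hL hε.le hpq hlen.le hs ht (hU s hs).1 h (hU t ht).2
      (hUd s hs) (hUd t ht)
  · rw [edist_comm, abs_sub_comm]
    exact edist_le_of_pathELength_le hc hL hε.le hpq hlen.le ht hs (hU t ht).1 h (hU s hs).2
      (hUd t ht) (hUd s hs)

/-- A point `q` at distance `L ≤ R` from `p` is joined to `p` by a metric geodesic if the ball
of radius `R` around `p` and `q` lie in a compact set. -/
theorem exists_metric_geodesic [IsRiemannianManifold (𝓡 n) M] {p q : M} {L R : ℝ}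
    (hL : 0 ≤ L) (hR : 0 < R) (hLR : L ≤ R)
    (hpq : edist p q = ENNReal.ofReal L) {K : Set M} (hK : IsCompact K)
    (hpK : Metric.eball p (ENNReal.ofReal R) ⊆ K) (hqK : q ∈ K) :
    ∃ γ : ℝ → M, γ 0 = p ∧ γ 1 = q ∧ ∀ s ∈ Icc (0 : ℝ) 1, ∀ t ∈ Icc (0 : ℝ) 1,
      edist (γ s) (γ t) ≤ ENNReal.ofReal (L * |s - t|) := by
  choose Γ hΓ1 hΓd hΓ using fun k : ℕ ↦
    exists_almost_geodesic (n := n) hL (Nat.one_div_pos_of_nat (α := ℝ) (n := k)) hpq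
  have hΓ0 : ∀ k, Γ k 0 = p := fun k ↦ by
    have := hΓd k 0 (by simp)
    simpa [eq_comm] using this
  -- For `s < 1` the distance `s * L` to `p` is below `R`, even if `L = R`; the endpoint is `q`
  -- itself.
  have hΓK : ∀ k, ∀ s ∈ Icc (0 : ℝ) 1, Γ k s ∈ K := by
    intro k s hs
    rcases eq_or_ne s 1 with rfl | hs1
    · rwa [hΓ1]
    · refine hpK ?_
      rw [Metric.mem_eball, edist_comm, hΓd k s hs, ENNReal.ofReal_lt_ofReal_iff hR]
      have hs1 : s < 1 := lt_of_le_of_ne hs.2 hs1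
      nlinarith [hs.1]
  -- A single ultrafilter gives limits for all `s` simultaneously, so no diagonal extraction or
  -- equicontinuity is needed.
  have hlim : ∀ s ∈ Icc (0 : ℝ) 1, ∃ x, Tendsto (fun k ↦ Γ k s) (hyperfilter ℕ) (𝓝 x) := by
    intro s hs
    obtain ⟨x, -, hx⟩ := hK.ultrafilter_le_nhds ((hyperfilter ℕ).map fun k ↦ Γ k s)
      (le_principal_iff.2 <| Ultrafilter.mem_map.2 <| Ultrafilter.mem_coe.1 <|
        Eventually.of_forall fun k ↦ hΓK k s hs)
    exact ⟨x, hx⟩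
  have : Nonempty M := ⟨p⟩
  choose! γ hγ using hlim
  refine ⟨γ, tendsto_nhds_unique (hγ 0 (by simp)) (by simp [hΓ0]),
    tendsto_nhds_unique (hγ 1 (by simp)) (by simp [hΓ1]), fun s hs t ht ↦ ?_⟩
  have h1 := (hγ s hs).edist (hγ t ht)
  have h2 : Tendsto (fun k : ℕ ↦ ENNReal.ofReal (L * |s - t| + 1 / ((k : ℝ) + 1)))
      (hyperfilter ℕ) (𝓝 (ENNReal.ofReal (L * |s - t|))) := by
    have h3 : Tendsto (fun k : ℕ ↦ L * |s - t| + 1 / ((k : ℝ) + 1)) atTop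
        (𝓝 (L * |s - t| + 0)) := tendsto_const_nhds.add tendsto_one_div_add_atTop_nhds_zero_nat
    rw [add_zero] at h3
    exact (ENNReal.tendsto_ofReal h3).mono_left (Nat.hyperfilter_le_atTop)
  exact le_of_tendsto_of_tendsto' h1 h2 fun k ↦ hΓ k s hs t ht

end MetricGeodesic

/-! ### From Euler-Lagrange to Christoffel symbols -/

section Christoffel

variable {n : ℕ} {M : Type*} [TopologicalSpace M] [ChartedSpace (EuclideanSpace ℝ (Fin n)) M]
  [Bundle.RiemannianBundle (fun x : M ↦ TangentSpace (𝓡 n) x)] [IsManifold (𝓡 n) ∞ M]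
  {φ : OpenPartialHomeomorph M (EuclideanSpace ℝ (Fin n))}

theorem isUnit_metricMatrix (hφ : φ ∈ IsManifold.maximalAtlas (𝓡 n) ∞ M)
    {y : EuclideanSpace ℝ (Fin n)} (hy : y ∈ φ.target) : IsUnit (metricMatrix φ y) := by
  rw [← Matrix.mulVec_injective_iff_isUnit]
  have hlin : ∀ v : Fin n → ℝ, (metricMatrix φ y).mulVec v = 0 → v = 0 := by
    intro v hv
    by_contra hne
    have hne' : WithLp.toLp 2 v ≠ 0 := fun h ↦ hne (by simpa using h)
    have hpos := chartForm_pos hφ hy hne'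
    rw [chartForm_apply] at hpos
    have : ∑ i, ∑ j, metricMatrix φ y i j * (v i * v j) =
        ∑ i, v i * (metricMatrix φ y).mulVec v i := by
      refine Finset.sum_congr rfl fun i _ ↦ ?_
      rw [Matrix.mulVec, dotProduct, Finset.mul_sum]
      exact Finset.sum_congr rfl fun j _ ↦ by ring
    rw [hv] at this
    simp only [Pi.zero_apply, mul_zero, Finset.sum_const_zero] at this
    exact hpos.ne' this
  intro v w hvw
  have := hlin (v - w) (by rw [Matrix.mulVec_sub, hvw, sub_self])
  exact sub_eq_zero.1 this

/-- The Euler-Lagrange equation of the energy, solved for the acceleration. -/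
theorem add_sum_christoffel_eq_zero
    [IsContMDiffRiemannianBundle (𝓡 n) ∞ (EuclideanSpace ℝ (Fin n))
      (fun x : M ↦ TangentSpace (𝓡 n) x)]
    (hφ : φ ∈ IsManifold.maximalAtlas (𝓡 n) ∞ M)
    {y v w : EuclideanSpace ℝ (Fin n)} (hy : y ∈ φ.target)
    (h : ∀ e, chartForm φ y w e + fderiv ℝ (chartForm φ) y v v e =
      (1 / 2) * fderiv ℝ (chartForm φ) y e v v) (k : Fin n) :
    w k + ∑ i, ∑ j, christoffel φ y k i j * v i * v j = 0 := by
  set G := metricMatrix φ y with hG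
  set T : Fin n → ℝ := fun l ↦ ∑ i, ∑ j,
    (metricPartial φ y i j l + metricPartial φ y j i l - metricPartial φ y l i j) * v i * v j
    with hT
  have hbv : ∀ i l : Fin n, basisVec n l i = if i = l then 1 else 0 := fun i l ↦ by
    rw [basisVec, PiLp.single_apply]
  have hGs : ∀ i j, G i j = G j i := fun i j ↦ by
    simp only [hG, metricMatrix, Matrix.of_apply]
    exact real_inner_comm _ _
  -- The equation with lowered index, obtained by testing against the `l`-th basis vector;
  -- multiplying by the inverse matrix raises the index.
  have hlow : ∀ l, ∑ i, G l i * w i = -(1 / 2) * T l := by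
    intro l
    have h1 := h (basisVec n l)
    rw [chartForm_apply, fderiv_chartForm_apply hφ hy, fderiv_chartForm_apply hφ hy] at h1
    simp only [hbv, mul_ite, mul_one, mul_zero, ite_mul, one_mul, zero_mul, Finset.sum_ite_eq',
      Finset.mem_univ, if_true, Finset.sum_const_zero, Finset.sum_ite_irrel] at h1
    -- Contracted with `vⁱ vʲ`, the terms `∂_i g_jl` and `∂_j g_il` have the same sum, so the single
    -- term of the Euler-Lagrange equation splits into two halves.
    have h2 : ∑ i, ∑ j, metricPartial φ y i j l * (v i * v j) =
        ∑ i, ∑ j, metricPartial φ y j i l * (v i * v j) := by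
      rw [Finset.sum_comm]
      exact Finset.sum_congr rfl fun i _ ↦ Finset.sum_congr rfl fun j _ ↦ by ring
    have h3 : T l = ∑ i, ∑ j, metricPartial φ y i j l * (v i * v j) +
        ∑ i, ∑ j, metricPartial φ y j i l * (v i * v j) -
        ∑ i, ∑ j, metricPartial φ y l i j * (v i * v j) := by
      simp only [hT, ← Finset.sum_add_distrib, ← Finset.sum_sub_distrib]
      exact Finset.sum_congr rfl fun i _ ↦ Finset.sum_congr rfl fun j _ ↦ by ring
    have h4 : ∑ i, G l i * w i = ∑ i, G i l * w i :=
      Finset.sum_congr rfl fun i _ ↦ by rw [hGs]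
    rw [h3, ← h2, h4]
    linarith
  have hinv : G⁻¹ * G = 1 :=
    Matrix.nonsing_inv_mul _ ((Matrix.isUnit_iff_isUnit_det _).1 (isUnit_metricMatrix hφ hy))
  have hw : w k = ∑ l, G⁻¹ k l * ∑ i, G l i * w i := by
    have h1 : (G⁻¹ * G).mulVec w k = w k := by rw [hinv, Matrix.one_mulVec]
    rw [← h1, ← Matrix.mulVec_mulVec]
    rfl
  have hΓ : ∑ i, ∑ j, christoffel φ y k i j * v i * v j = (1 / 2) * ∑ l, G⁻¹ k l * T l := by
    simp only [hT, christoffel, ← hG, Finset.mul_sum, Finset.sum_mul]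
    rw [Finset.sum_comm_cycle]
    refine Finset.sum_congr rfl fun l _ ↦ Finset.sum_congr rfl fun i _ ↦
      Finset.sum_congr rfl fun j _ ↦ ?_
    ring
  rw [hΓ, hw, Finset.mul_sum, ← Finset.sum_add_distrib]
  refine Finset.sum_eq_zero fun l _ ↦ ?_
  rw [hlow]
  ring

end Christoffel

/-! ### Metric speed and Riemannian speed -/

section Speed

open Set Filter
open scoped Topology

theorem sqrt_form_smul {E : Type*} [NormedAddCommGroup E] [NormedSpace ℝ E]
    (B : E →L[ℝ] E →L[ℝ] ℝ) (c : ℝ) (v : E) :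
    √(B (c • v) (c • v)) = |c| * √(B v v) := by
  rw [map_smul, map_smul, smul_apply, smul_eq_mul, smul_eq_mul, ← mul_assoc,
    Real.sqrt_mul (mul_self_nonneg c), Real.sqrt_mul_self_eq_abs]

theorem tendsto_sqrt_form_slope {E : Type*} [NormedAddCommGroup E] [NormedSpace ℝ E]
    (B : E →L[ℝ] E →L[ℝ] ℝ) {y : ℝ → E} {v : E} {t : ℝ} (hy : HasDerivAt y v t) :
    Tendsto (fun s ↦ √(B (slope y t s) (slope y t s))) (𝓝[≠] t)
      (𝓝 √(B v v)) := by
  have hc : Continuous fun w ↦ √(B w w) := by fun_prop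
  exact (hc.tendsto v).comp hy.tendsto_slope

variable {n : ℕ} {M : Type*} [EMetricSpace M] [ChartedSpace (EuclideanSpace ℝ (Fin n)) M]
  [IsManifold (𝓡 n) ∞ M] [Bundle.RiemannianBundle (fun x : M ↦ TangentSpace (𝓡 n) x)]
  [IsContMDiffRiemannianBundle (𝓡 n) ∞ (EuclideanSpace ℝ (Fin n))
    (fun x : M ↦ TangentSpace (𝓡 n) x)] [IsRiemannianManifold (𝓡 n) M]
  {φ : OpenPartialHomeomorph M (EuclideanSpace ℝ (Fin n))}

/-- The lower comparison of distance with the form at `y t` bounds the norm of the difference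
quotients by `(1 + ε) * L`; then pass to the limit. -/
theorem sqrt_chartForm_deriv_le (hφ : φ ∈ IsManifold.maximalAtlas (𝓡 n) ∞ M)
    {y : ℝ → EuclideanSpace ℝ (Fin n)} {v : EuclideanSpace ℝ (Fin n)} {t L : ℝ}
    (hy : HasDerivAt y v t) (hyt : y t ∈ φ.target) (hL : 0 ≤ L)
    (h : ∀ᶠ s in 𝓝 t, edist (φ.symm (y t)) (φ.symm (y s)) ≤ ENNReal.ofReal (L * |s - t|)) :
    √(chartForm φ (y t) v v) ≤ L := by
  refine le_of_forall_pos_le_add fun δ hδ ↦ ?_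
  -- Makes `ε * L ≤ δ`, with a nonzero denominator even if `L = 0`.
  set ε := δ / (L + 1) with hε
  have hε0 : 0 < ε := by positivity
  obtain ⟨r, hr, -, hr'⟩ := exists_ball_edist_symm_bounds hφ hyt hε0
  have hev : ∀ᶠ s in 𝓝[≠] t,
      √(chartForm φ (y t) (slope y t s) (slope y t s)) ≤ (1 + ε) * L := by
    have hball := hy.continuousAt (Metric.ball_mem_nhds _ hr)
    filter_upwards [nhdsWithin_le_nhds h, nhdsWithin_le_nhds hball, self_mem_nhdsWithin]
      with s hs hsb hst
    have hst' : 0 < |s - t| := abs_pos.2 (sub_ne_zero.2 hst)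
    have h1 := (hr' (y t) (Metric.mem_ball_self hr) (y s) hsb).2.trans
      (mul_le_mul_right hs _)
    rw [← ENNReal.ofReal_mul (by linarith), ENNReal.ofReal_le_ofReal_iff (by positivity)] at h1
    rw [slope_def_module, sqrt_form_smul, abs_inv, inv_mul_le_iff₀ hst']
    linarith
  have h2 := le_of_tendsto (tendsto_sqrt_form_slope _ hy) hev
  refine h2.trans ?_
  have : ε * L ≤ δ := by
    rw [hε, div_mul_eq_mul_div, div_le_iff₀ (by linarith)]
    nlinarith
  linarith

/-- The dual estimate: a function varying no faster than the distance along the curve has derivative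
at most the speed. It is applied to the distance from the initial point. -/
theorem abs_deriv_le_sqrt_chartForm (hφ : φ ∈ IsManifold.maximalAtlas (𝓡 n) ∞ M)
    {y : ℝ → EuclideanSpace ℝ (Fin n)} {v : EuclideanSpace ℝ (Fin n)} {f : ℝ → ℝ} {f' t : ℝ}
    (hy : HasDerivAt y v t) (hyt : y t ∈ φ.target) (hf : HasDerivAt f f' t)
    (h : ∀ᶠ s in 𝓝 t, ENNReal.ofReal |f s - f t| ≤ edist (φ.symm (y t)) (φ.symm (y s))) :
    |f'| ≤ √(chartForm φ (y t) v v) := by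
  set A := √(chartForm φ (y t) v v) with hA
  have hA0 : 0 ≤ A := Real.sqrt_nonneg _
  refine le_of_forall_pos_le_add fun δ hδ ↦ ?_
  set ε := δ / (A + 1) with hε
  have hε0 : 0 < ε := by positivity
  obtain ⟨r, hr, -, hr'⟩ := exists_ball_edist_symm_bounds hφ hyt hε0
  have hev : ∀ᶠ s in 𝓝[≠] t,
      |slope f t s| ≤ (1 + ε) * √(chartForm φ (y t) (slope y t s) (slope y t s)) := by
    have hball := hy.continuousAt (Metric.ball_mem_nhds _ hr)
    filter_upwards [nhdsWithin_le_nhds h, nhdsWithin_le_nhds hball, self_mem_nhdsWithin]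
      with s hs hsb hst
    have hst' : 0 < |s - t| := abs_pos.2 (sub_ne_zero.2 hst)
    have h1 := hs.trans (hr' (y t) (Metric.mem_ball_self hr) (y s) hsb).1
    rw [ENNReal.ofReal_le_ofReal_iff (by positivity)] at h1
    rw [slope_def_module, slope_def_module, sqrt_form_smul, abs_inv, smul_eq_mul, abs_mul, abs_inv,
      inv_mul_le_iff₀ hst']
    calc |f s - f t| ≤ _ := h1
      _ = |s - t| * ((1 + ε) * (|s - t|⁻¹ * √(chartForm φ (y t) (y s - y t) (y s - y t)))) := by
        field_simp
  have h2 : |f'| ≤ (1 + ε) * A :=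
    le_of_tendsto_of_tendsto hf.tendsto_slope.abs
      ((tendsto_sqrt_form_slope _ hy).const_mul (1 + ε)) hev
  refine h2.trans ?_
  have : ε * A ≤ δ := by
    rw [hε, div_mul_eq_mul_div, div_le_iff₀ (by linarith)]
    nlinarith
  linarith

end Speed

/-! ### Integrability of the energy density -/

section Variational

open MeasureTheory Set

attribute [-instance]
  Bundle.instNormedAddCommGroupOfRiemannianBundleOfIsTopologicalAddGroupOfContinuousConstSMulReal
  Bundle.instInnerProductSpaceReal

theorem intervalIntegrable_form_deriv {E : Type*} [NormedAddCommGroup E] [NormedSpace ℝ E]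
    [FiniteDimensional ℝ E] {g : E → E →L[ℝ] E →L[ℝ] ℝ} {a b C : ℝ} (hab : a ≤ b) {y : ℝ → E}
    {K : NNReal} (hg : ContinuousOn (fun t ↦ g (y t)) (Icc a b))
    (hC : ∀ t ∈ Icc a b, ‖g (y t)‖ ≤ C) (hy : LipschitzWith K y) :
    IntervalIntegrable (fun t ↦ g (y t) (deriv y t) (deriv y t)) volume a b := by
  refine intervalIntegrable_of_bounded (C := C * K * K) hab ?_ fun t ht ↦
    ContinuousLinearMap.le_of_opNorm₂_le_of_le _ (hC t ht)
      (norm_deriv_le_of_lipschitz hy) (norm_deriv_le_of_lipschitz hy)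
  have hsub : uIoc a b ⊆ Icc a b := by
    rw [uIoc_of_le hab]; exact Ioc_subset_Icc_self
  exact (show Continuous fun q : (E →L[ℝ] E →L[ℝ] ℝ) × E ↦ q.1 q.2 q.2 by
    fun_prop).comp_aestronglyMeasurable
      (((hg.mono hsub).aestronglyMeasurable measurableSet_uIoc).prodMk
        (stronglyMeasurable_deriv y).aestronglyMeasurable)

end Variational

/-! ### Metric geodesics minimize the energy locally -/

section Minimizing

open Set Filter MeasureTheory
open scoped Topology

variable {n : ℕ} {M : Type*} [EMetricSpace M] [ChartedSpace (EuclideanSpace ℝ (Fin n)) M]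
  [IsManifold (𝓡 n) ∞ M] [Bundle.RiemannianBundle (fun x : M ↦ TangentSpace (𝓡 n) x)]
  [IsContMDiffRiemannianBundle (𝓡 n) ∞ (EuclideanSpace ℝ (Fin n))
    (fun x : M ↦ TangentSpace (𝓡 n) x)] [IsRiemannianManifold (𝓡 n) M]
  {φ : OpenPartialHomeomorph M (EuclideanSpace ℝ (Fin n))}

/-- Makes the chart bi-Lipschitz for the Riemannian distance, so metric geodesics become Lipschitz
in coordinates, with one constant for every bound the variational argument needs. -/
theorem exists_ball_uniform_bounds (hφ : φ ∈ IsManifold.maximalAtlas (𝓡 n) ∞ M)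
    {z : EuclideanSpace ℝ (Fin n)} (hz : z ∈ φ.target) :
    ∃ r > 0, ∃ C : NNReal, Metric.ball z r ⊆ φ.target ∧
      (∀ y ∈ Metric.ball z r, ‖chartForm φ y‖ ≤ C) ∧
      (∀ y ∈ Metric.ball z r, ‖fderiv ℝ (chartForm φ) y‖ ≤ C) ∧
      ∀ u ∈ Metric.ball z r, ∀ v ∈ Metric.ball z r,
        edist (φ.symm u) (φ.symm v) ≤ C * edist u v ∧
        edist u v ≤ C * edist (φ.symm u) (φ.symm v) := by
  obtain ⟨r₁, hr₁, ht, hd⟩ := exists_ball_edist_symm_bounds hφ hz one_pos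
  have hs := contDiffOn_chartForm hφ
  have hg : ContinuousAt (chartForm φ) z :=
    hs.continuousOn.continuousAt (φ.open_target.mem_nhds hz)
  have hg' : ContinuousAt (fderiv ℝ (chartForm φ)) z :=
    (hs.continuousOn_fderiv_of_isOpen φ.open_target le_rfl).continuousAt
      (φ.open_target.mem_nhds hz)
  set A := ‖chartForm φ z‖ + 1 with hA
  set A' := ‖fderiv ℝ (chartForm φ) z‖ + 1 with hA'
  have e1 : ∀ᶠ y in 𝓝 z, ‖chartForm φ y‖ < A := hg.norm.eventually_lt_const (lt_add_one _)
  have e2 : ∀ᶠ y in 𝓝 z, ‖fderiv ℝ (chartForm φ) y‖ < A' :=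
    hg'.norm.eventually_lt_const (lt_add_one _)
  obtain ⟨r₂, hr₂, h12⟩ := Metric.mem_nhds_iff.1 (e1.and e2)
  obtain ⟨c, hc, hcz⟩ := exists_pos_mul_norm_sq_le
    (fun v hv ↦ chartForm_pos hφ hz (v := v) hv)
  have hA0 : 0 ≤ A := by positivity
  have hA0' : 0 ≤ A' := by positivity
  -- The factors `2` are `1 + ε` with `ε = 1`; `√A` and `1 / √c` compare the form at `z` with the
  -- Euclidean norm from above and below.
  set D := 2 * √A + 2 / √c with hD
  have hD0 : 0 ≤ D := by positivity
  have hsub1 : Metric.ball z (min r₁ r₂) ⊆ Metric.ball z r₁ :=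
    Metric.ball_subset_ball (min_le_left _ _)
  have hsub2 : Metric.ball z (min r₁ r₂) ⊆ Metric.ball z r₂ :=
    Metric.ball_subset_ball (min_le_right _ _)
  refine ⟨min r₁ r₂, lt_min hr₁ hr₂, (A + A' + D).toNNReal, hsub1.trans ht,
    fun y hy ↦ ?_, fun y hy ↦ ?_, fun u hu v hv ↦ ⟨?_, ?_⟩⟩
  · rw [Real.coe_toNNReal _ (by positivity)]
    linarith [(h12 (hsub2 hy)).1]
  · rw [Real.coe_toNNReal _ (by positivity)]
    linarith [(h12 (hsub2 hy)).2]
  · refine (hd u (hsub1 hu) v (hsub1 hv)).1.trans ?_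
    rw [edist_comm, edist_dist, dist_eq_norm, ← ENNReal.ofReal_coe_nnreal,
      Real.coe_toNNReal _ (by positivity), ← ENNReal.ofReal_mul (by positivity)]
    refine ENNReal.ofReal_le_ofReal ?_
    have h1 : chartForm φ z (v - u) (v - u) ≤ A * ‖v - u‖ ^ 2 := by
      have := ContinuousLinearMap.le_of_opNorm₂_le_of_le (chartForm φ z)
        (h12 (Metric.mem_ball_self hr₂)).1.le (le_refl ‖v - u‖) (le_refl ‖v - u‖)
      calc _ ≤ ‖chartForm φ z (v - u) (v - u)‖ := le_abs_self _
        _ ≤ _ := this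
        _ = _ := by ring
    have h2 : √(chartForm φ z (v - u) (v - u)) ≤ √A * ‖v - u‖ := by
      refine (Real.sqrt_le_sqrt h1).trans_eq ?_
      rw [Real.sqrt_mul hA0, Real.sqrt_sq (norm_nonneg _)]
    calc (1 + 1) * √(chartForm φ z (v - u) (v - u)) ≤ (1 + 1) * (√A * ‖v - u‖) := by gcongr
      _ = (2 * √A) * ‖v - u‖ := by ring
      _ ≤ _ := by
        gcongr
        have : 0 ≤ 2 / √c := by positivity
        linarith
  · have h1 : √c * ‖v - u‖ ≤ √(chartForm φ z (v - u) (v - u)) := by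
      refine Eq.trans_le ?_ (Real.sqrt_le_sqrt (hcz (v - u)))
      rw [Real.sqrt_mul hc.le, Real.sqrt_sq (norm_nonneg _)]
    have h2 := (ENNReal.ofReal_le_ofReal h1).trans (hd u (hsub1 hu) v (hsub1 hv)).2
    have hsc : 0 < √c := Real.sqrt_pos.2 hc
    have h3 : edist u v = ENNReal.ofReal (1 / √c) * ENNReal.ofReal (√c * ‖v - u‖) := by
      rw [edist_comm, edist_dist, dist_eq_norm, ← ENNReal.ofReal_mul (by positivity)]
      congr 1
      field_simp
    rw [h3]
    refine (mul_le_mul_right h2 _).trans ?_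
    rw [← mul_assoc, ← ENNReal.ofReal_mul (by positivity), ← ENNReal.ofReal_coe_nnreal,
      Real.coe_toNNReal _ (by positivity)]
    gcongr
    have : 1 / √c * (1 + 1) = 2 / √c := by ring
    have : 0 ≤ √A := Real.sqrt_nonneg _
    linarith

/-- A curve in a chart whose endpoints are at distance `L * (b - a)` has energy at least
`L ^ 2 * (b - a)`. -/
theorem sq_mul_le_integral_chartForm (hφ : φ ∈ IsManifold.maximalAtlas (𝓡 n) ∞ M)
    {V : Set (EuclideanSpace ℝ (Fin n))} (hVt : V ⊆ φ.target) {C : NNReal}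
    (hC : ∀ y ∈ V, ‖chartForm φ y‖ ≤ C)
    (hd : ∀ u ∈ V, ∀ v ∈ V, edist (φ.symm u) (φ.symm v) ≤ C * edist u v)
    {a b L : ℝ} (hab : a < b) (hL : 0 ≤ L)
    {y : ℝ → EuclideanSpace ℝ (Fin n)} {K : NNReal} (hy : LipschitzWith K y)
    (hyV : ∀ t ∈ Icc a b, y t ∈ V)
    (hdist : edist (φ.symm (y a)) (φ.symm (y b)) = ENNReal.ofReal (L * (b - a))) :
    L ^ 2 * (b - a) ≤ ∫ t in a..b, chartForm φ (y t) (deriv y t) (deriv y t) := by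
  have ha : a ∈ Icc a b := ⟨le_rfl, hab.le⟩
  set f : ℝ → ℝ := fun t ↦ (edist (φ.symm (y a)) (φ.symm (y t))).toReal with hf
  have hfin : ∀ s ∈ Icc a b, ∀ t ∈ Icc a b, edist (φ.symm (y s)) (φ.symm (y t)) ≠ ⊤ :=
    fun s hs t ht ↦ ((hd _ (hyV s hs) _ (hyV t ht)).trans_lt
      (ENNReal.mul_lt_top ENNReal.coe_lt_top (edist_lt_top _ _))).ne
  have hfle : ∀ s ∈ Icc a b, ∀ t ∈ Icc a b,
      f s - f t ≤ (edist (φ.symm (y t)) (φ.symm (y s))).toReal := by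
    intro s hs t ht
    rw [sub_le_iff_le_add', ← ENNReal.toReal_add (hfin a ha t ht) (hfin t ht s hs)]
    exact ENNReal.toReal_mono (ENNReal.add_ne_top.2 ⟨hfin a ha t ht, hfin t ht s hs⟩)
      (edist_triangle _ _ _)
  have hfabs : ∀ s ∈ Icc a b, ∀ t ∈ Icc a b,
      |f s - f t| ≤ (edist (φ.symm (y t)) (φ.symm (y s))).toReal := fun s hs t ht ↦
    abs_sub_le_iff.2 ⟨hfle s hs t ht, by rw [edist_comm]; exact hfle t ht s hs⟩
  have hlip : LipschitzOnWith (C * K) f (uIcc a b) := by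
    rw [uIcc_of_le hab.le]
    intro s hs t ht
    rw [edist_dist, Real.dist_eq]
    refine (ENNReal.ofReal_le_of_le_toReal (hfabs s hs t ht)).trans ?_
    rw [edist_comm]
    refine (hd _ (hyV s hs) _ (hyV t ht)).trans ?_
    rw [ENNReal.coe_mul, mul_assoc]
    gcongr
    exact hy s t
  have hac := hlip.absolutelyContinuousOnInterval
  have hFTC := hac.integral_deriv_eq_sub
  have hfa : f a = 0 := by simp [hf]
  have hfb : f b = L * (b - a) := by
    simp only [hf, hdist]
    exact ENNReal.toReal_ofReal (mul_nonneg hL (sub_pos.2 hab).le)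
  rw [hfa, hfb, sub_zero] at hFTC
  have hint : IntervalIntegrable (fun t ↦ chartForm φ (y t) (deriv y t) (deriv y t))
      volume a b := by
    refine intervalIntegrable_form_deriv hab.le ?_ (fun t ht ↦ hC _ (hyV t ht)) hy
    exact (contDiffOn_chartForm hφ).continuousOn.comp hy.continuous.continuousOn
      fun t ht ↦ hVt (hyV t ht)
  have hne : ∀ c : ℝ, ∀ᵐ t : ℝ, t ≠ c := fun c ↦ by simp [ae_iff, measure_singleton]
  -- With `q` the speed, `f' ≤ q` and `(L - q) ^ 2 ≥ 0` give `2 * L * f' - L ^ 2 ≤ q ^ 2`.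
  -- Integrating this linear bound replaces the Cauchy-Schwarz inequality for integrals.
  have hpt : ∀ᵐ t, t ∈ Icc a b → 2 * L * deriv f t - L ^ 2 ≤
      chartForm φ (y t) (deriv y t) (deriv y t) := by
    filter_upwards [hac.ae_differentiableAt, hy.ae_differentiableAt_real, hne a, hne b]
      with t h1 h2 hta htb ht
    have htI : Icc a b ∈ 𝓝 t :=
      Icc_mem_nhds (lt_of_le_of_ne ht.1 (Ne.symm hta)) (lt_of_le_of_ne ht.2 htb)
    have hft := (h1 (by rwa [uIcc_of_le hab.le])).hasDerivAt
    have hle := abs_deriv_le_sqrt_chartForm hφ h2.hasDerivAt (hVt (hyV t ht)) hft (by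
      filter_upwards [htI] with s hs
      exact ENNReal.ofReal_le_of_le_toReal (hfabs s hs t ht))
    set q := √(chartForm φ (y t) (deriv y t) (deriv y t)) with hq
    have hq2 : q ^ 2 = chartForm φ (y t) (deriv y t) (deriv y t) :=
      Real.sq_sqrt (by rw [chartForm_self]; positivity)
    rw [← hq2]
    nlinarith [sq_nonneg (L - q), (abs_le.1 hle).2]
  have hI : IntervalIntegrable (fun t ↦ 2 * L * deriv f t - L ^ 2) volume a b :=
    (hac.intervalIntegrable_deriv.const_mul _).sub (by simp)
  have := intervalIntegral.integral_mono_ae_restrict hab.le hI hint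
    ((ae_restrict_iff' measurableSet_Icc).2 hpt)
  rw [intervalIntegral.integral_sub (hac.intervalIntegrable_deriv.const_mul _) (by simp),
    intervalIntegral.integral_const_mul, hFTC, intervalIntegral.integral_const, smul_eq_mul] at this
  linarith

theorem continuousOn_of_edist_eq {X : Type*} [PseudoEMetricSpace X] {γ : ℝ → X} {L : ℝ}
    (hL : 0 ≤ L) (hγ : ∀ s ∈ Icc (0 : ℝ) 1, ∀ t ∈ Icc (0 : ℝ) 1,
      edist (γ s) (γ t) = ENNReal.ofReal (L * |s - t|)) : ContinuousOn γ (Icc 0 1) := by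
  refine LipschitzOnWith.continuousOn (K := L.toNNReal) fun s hs t ht ↦ ?_
  rw [hγ s hs t ht, edist_dist, Real.dist_eq, ENNReal.ofReal_mul hL]
  rfl

/-- A metric geodesic minimizes the energy in a chart; hence it is of class `C²` there and
satisfies the Euler-Lagrange equation of the energy. -/
theorem exists_euler_lagrange_of_metric_geodesic (hφ : φ ∈ IsManifold.maximalAtlas (𝓡 n) ∞ M)
    {γ : ℝ → M} {L : ℝ} (hL : 0 ≤ L)
    (hγ : ∀ s ∈ Icc (0 : ℝ) 1, ∀ t ∈ Icc (0 : ℝ) 1,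
      edist (γ s) (γ t) = ENNReal.ofReal (L * |s - t|))
    {t₀ : ℝ} (ht₀ : t₀ ∈ Icc (0 : ℝ) 1) (hsrc : γ t₀ ∈ φ.source) :
    ∃ a b, a < b ∧ t₀ ∈ Icc a b ∧ Icc a b ⊆ Icc 0 1 ∧ Icc a b ∈ 𝓝[Icc 0 1] t₀ ∧
      (∀ t ∈ Icc a b, γ t ∈ φ.source) ∧
      ∃ v w : ℝ → EuclideanSpace ℝ (Fin n), Continuous w ∧
        (∀ t ∈ Icc a b, HasDerivWithinAt (fun τ ↦ φ (γ τ)) (v t) (Icc a b) t) ∧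
        (∀ t ∈ Icc a b, HasDerivWithinAt v (w t) (Icc a b) t) ∧
        ∀ t ∈ Icc a b, ∀ e, chartForm φ (φ (γ t)) (w t) e +
          fderiv ℝ (chartForm φ) (φ (γ t)) (v t) (v t) e =
            (1 / 2) * fderiv ℝ (chartForm φ) (φ (γ t)) e (v t) (v t) := by
  obtain ⟨r, hr, C, hVt, hC, hC', hd⟩ := exists_ball_uniform_bounds hφ (φ.map_source hsrc)
  set z := φ (γ t₀) with hz
  have hγc := continuousOn_of_edist_eq hL hγ
  have hnear : γ ⁻¹' (φ.source ∩ φ ⁻¹' Metric.ball z (r / 2)) ∈ 𝓝[Icc 0 1] t₀ :=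
    hγc t₀ ht₀ (Filter.inter_mem (φ.open_source.mem_nhds hsrc)
      (φ.continuousAt hsrc (Metric.ball_mem_nhds z (half_pos hr))))
  obtain ⟨η, hη, hηs⟩ := Metric.mem_nhdsWithin_iff.1 hnear
  -- Truncating to `[0, 1]` covers the endpoints: `[a, b]` is a neighbourhood of `t₀` only relative
  -- to `[0, 1]`.
  set a := max 0 (t₀ - η / 2) with ha
  set b := min 1 (t₀ + η / 2) with hb
  have hab : a < b := by
    simp only [ha, hb, lt_min_iff, max_lt_iff]
    refine ⟨⟨one_pos, ?_⟩, ?_, ?_⟩ <;> linarith [ht₀.1, ht₀.2]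
  have ht₀ab : t₀ ∈ Icc a b :=
    ⟨max_le ht₀.1 (by linarith), le_min ht₀.2 (by linarith)⟩
  have hsub : Icc a b ⊆ Icc 0 1 := Icc_subset_Icc (le_max_left _ _) (min_le_left _ _)
  have hmem : ∀ t ∈ Icc a b, γ t ∈ φ.source ∧ φ (γ t) ∈ Metric.ball z (r / 2) := by
    intro t ht
    refine hηs ⟨?_, hsub ht⟩
    have h1 := (le_max_right _ _).trans ht.1
    have h2 := ht.2.trans (min_le_right _ _)
    rw [Metric.mem_ball, Real.dist_eq, abs_lt]
    constructor <;> linarith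
  have hnhds : Icc a b ∈ 𝓝[Icc 0 1] t₀ := by
    refine mem_nhdsWithin_iff_exists_mem_nhds_inter.2 ⟨Icc (t₀ - η / 2) (t₀ + η / 2),
      Icc_mem_nhds (by linarith) (by linarith), fun t ht ↦ ⟨max_le ht.2.1 ht.1.1,
      le_min ht.2.2 ht.1.2⟩⟩
  refine ⟨a, b, hab, ht₀ab, hsub, hnhds, fun t ht ↦ (hmem t ht).1, ?_⟩
  -- extend the curve read in the chart by constants
  set x : ℝ → EuclideanSpace ℝ (Fin n) := fun t ↦ φ (γ (projIcc a b hab.le t)) with hx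
  have hxeq : ∀ t ∈ Icc a b, x t = φ (γ t) := fun t ht ↦ by
    simp only [hx, projIcc_of_mem hab.le ht]
  have hxball : ∀ t, x t ∈ Metric.ball z (r / 2) := fun t ↦
    (hmem _ (projIcc a b hab.le t).2).2
  have hhalf : Metric.ball z (r / 2) ⊆ Metric.ball z r := Metric.ball_subset_ball (by linarith)
  -- The curve was confined to the ball of radius `r / 2`, leaving a margin `r / 2` for variations
  -- inside `V`.
  have hxV : ∀ t, Metric.ball (x t) (r / 2) ⊆ Metric.ball z r := fun t ↦ by
    refine Metric.ball_subset_ball' ?_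
    have := hxball t
    rw [Metric.mem_ball] at this
    linarith
  have hxsymm : ∀ t, φ.symm (x t) = γ (projIcc a b hab.le t) := fun t ↦
    φ.left_inv (hmem _ (projIcc a b hab.le t).2).1
  have hxlip : LipschitzWith (C * L.toNNReal) x := by
    intro s t
    refine (hd _ (hhalf (hxball s)) _ (hhalf (hxball t))).2.trans ?_
    rw [hxsymm, hxsymm, ENNReal.coe_mul, mul_assoc,
      hγ _ (hsub (projIcc a b hab.le s).2) _ (hsub (projIcc a b hab.le t).2),
      ENNReal.ofReal_mul hL]
    gcongr
    · rfl
    · rw [← Real.dist_eq, ← edist_dist]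
      exact (LipschitzWith.projIcc hab.le s t).trans (by simp)
  have hspeed : ∀ᵐ t, t ∈ Icc a b → chartForm φ (x t) (deriv x t) (deriv x t) ≤ L ^ 2 := by
    have hne : ∀ c : ℝ, ∀ᵐ t : ℝ, t ≠ c := fun c ↦ by simp [ae_iff, measure_singleton]
    filter_upwards [hxlip.ae_differentiableAt_real, hne a, hne b] with t h1 hta htb ht
    have htI : Icc a b ∈ 𝓝 t :=
      Icc_mem_nhds (lt_of_le_of_ne ht.1 (Ne.symm hta)) (lt_of_le_of_ne ht.2 htb)
    have hle := sqrt_chartForm_deriv_le hφ h1.hasDerivAt (hVt (hhalf (hxball t))) hL (by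
      filter_upwards [htI] with s hs
      rw [hxsymm, hxsymm, projIcc_of_mem hab.le ht, projIcc_of_mem hab.le hs,
        hγ _ (hsub ht) _ (hsub hs), abs_sub_comm])
    exact (Real.sqrt_le_left hL).1 hle
  have hxint : IntervalIntegrable (fun t ↦ chartForm φ (x t) (deriv x t) (deriv x t))
      volume a b :=
    intervalIntegrable_form_deriv hab.le ((contDiffOn_chartForm hφ).continuousOn.comp
      hxlip.continuous.continuousOn fun t _ ↦ hVt (hhalf (hxball t)))
      (fun t _ ↦ hC _ (hhalf (hxball t))) hxlip
  have henergy : ∫ t in a..b, chartForm φ (x t) (deriv x t) (deriv x t) ≤ L ^ 2 * (b - a) := by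
    have := intervalIntegral.integral_mono_ae_restrict hab.le hxint
      (intervalIntegrable_const (c := L ^ 2)) ((ae_restrict_iff' measurableSet_Icc).2 hspeed)
    rw [intervalIntegral.integral_const, smul_eq_mul] at this
    linarith
  have haI : a ∈ Icc a b := ⟨le_rfl, hab.le⟩
  have hbI : b ∈ Icc a b := ⟨hab.le, le_rfl⟩
  -- The energy of `x` is at most `L ^ 2 * (b - a)`, since its speed is at most `L` a.e.; a
  -- competitor joins the same points at distance `L * (b - a)`, so it has at least that energy.
  have hmin : ∀ y : ℝ → EuclideanSpace ℝ (Fin n), (∃ K', LipschitzWith K' y) →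
      (∀ t ∈ Icc a b, y t ∈ Metric.ball z r) → y a = x a → y b = x b →
      ∫ t in a..b, chartForm φ (x t) (deriv x t) (deriv x t) ≤
        ∫ t in a..b, chartForm φ (y t) (deriv y t) (deriv y t) := by
    rintro y ⟨K', hy⟩ hyV hya hyb
    refine henergy.trans (sq_mul_le_integral_chartForm hφ hVt hC
      (fun u hu v hv ↦ (hd u hu v hv).1) hab hL hy hyV ?_)
    rw [hya, hyb, hxsymm, hxsymm, projIcc_of_mem hab.le haI, projIcc_of_mem hab.le hbI,
      hγ _ (hsub haI) _ (hsub hbI), abs_sub_comm, abs_of_pos (sub_pos.2 hab)]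
  obtain ⟨v, w, hw, hxv, hvw, hEL⟩ := exists_hasDerivWithinAt_of_energy_minimizing
    Metric.isOpen_ball ((contDiffOn_chartForm hφ).mono hVt) hC hC'
    (fun y _ ↦ chartForm_symm φ y) (fun y hy v hv ↦ chartForm_pos hφ (hVt hy) hv) hab hxlip
    (half_pos hr) hxV hmin
  refine ⟨v, w, hw, fun t ht ↦ ?_, hvw, fun t ht e ↦ ?_⟩
  · exact (hxv t ht).congr (fun s hs ↦ (hxeq s hs).symm) (hxeq t ht).symm
  · rw [← hxeq t ht]
    exact hEL t ht e

end Minimizing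

/-! ### From metric geodesics to minimizing geodesics -/

section MinimizingGeodesic

open Set Filter MeasureTheory Manifold
open scoped Topology

variable {n : ℕ} {M : Type*} [EMetricSpace M] [ChartedSpace (EuclideanSpace ℝ (Fin n)) M]

/-- The upper bounds on the three pieces cut out by `s` and `t` add up to exactly `L`, so the
triangle inequality leaves no slack in the middle piece. -/
theorem edist_eq_of_edist_le {X : Type*} [PseudoEMetricSpace X] {γ : ℝ → X} {L : ℝ} (hL : 0 ≤ L)
    (h01 : edist (γ 0) (γ 1) = ENNReal.ofReal L)
    (hγ : ∀ s ∈ Icc (0 : ℝ) 1, ∀ t ∈ Icc (0 : ℝ) 1,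
      edist (γ s) (γ t) ≤ ENNReal.ofReal (L * |s - t|)) :
    ∀ s ∈ Icc (0 : ℝ) 1, ∀ t ∈ Icc (0 : ℝ) 1,
      edist (γ s) (γ t) = ENNReal.ofReal (L * |s - t|) := by
  have key : ∀ s t : ℝ, 0 ≤ s → s ≤ t → t ≤ 1 →
      ENNReal.ofReal (L * |s - t|) ≤ edist (γ s) (γ t) := by
    intro s t hs hst ht
    have hs' : s ∈ Icc (0 : ℝ) 1 := ⟨hs, hst.trans ht⟩
    have ht' : t ∈ Icc (0 : ℝ) 1 := ⟨hs.trans hst, ht⟩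
    have h1 := (edist_triangle4 (γ 0) (γ s) (γ t) (γ 1)).trans
      (add_le_add (add_le_add_left (hγ 0 (by simp) s hs') _) (hγ t ht' 1 (by simp)))
    have hfin : edist (γ s) (γ t) ≠ ⊤ := ne_top_of_le_ne_top ENNReal.ofReal_ne_top (hγ s hs' t ht')
    rw [h01, ← ENNReal.ofReal_toReal hfin, ← ENNReal.ofReal_add (by positivity) (by positivity),
      ← ENNReal.ofReal_add (by positivity) (by positivity),
      ENNReal.ofReal_le_ofReal_iff (by positivity), zero_sub, abs_neg, abs_of_nonneg hs,
      abs_of_nonpos (by linarith : t - 1 ≤ 0)] at h1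
    rw [← ENNReal.ofReal_toReal hfin, abs_of_nonpos (by linarith : s - t ≤ 0)]
    exact ENNReal.ofReal_le_ofReal (by linarith)
  intro s hs t ht
  refine (hγ s hs t ht).antisymm ?_
  rcases le_total s t with h | h
  · exact key s t hs.1 h ht.2
  · rw [abs_sub_comm, edist_comm]
    exact key t s ht.1 h hs.2

theorem contDiffOn_two_of_hasDerivWithinAt {F : Type*} [NormedAddCommGroup F] [NormedSpace ℝ F]
    {f v w : ℝ → F} {s : Set ℝ} (hs : UniqueDiffOn ℝ s) (hw : ContinuousOn w s)
    (hf : ∀ t ∈ s, HasDerivWithinAt f (v t) s t) (hv : ∀ t ∈ s, HasDerivWithinAt v (w t) s t) :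
    ContDiffOn ℝ 2 f s := by
  have hv1 : ContDiffOn ℝ 1 v s := by
    rw [show (1 : WithTop ℕ∞) = 0 + 1 from rfl, contDiffOn_succ_iff_derivWithin hs]
    refine ⟨fun t ht ↦ (hv t ht).differentiableWithinAt, by simp, ?_⟩
    rw [contDiffOn_zero]
    exact hw.congr fun t ht ↦ (hv t ht).derivWithin (hs t ht)
  rw [show (2 : WithTop ℕ∞) = 1 + 1 from rfl, contDiffOn_succ_iff_derivWithin hs]
  exact ⟨fun t ht ↦ (hf t ht).differentiableWithinAt, by simp,
    hv1.congr fun t ht ↦ (hf t ht).derivWithin (hs t ht)⟩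

variable [Bundle.RiemannianBundle (fun x : M ↦ TangentSpace (𝓡 n) x)]
  [IsManifold (𝓡 n) ∞ M]
  [IsContMDiffRiemannianBundle (𝓡 n) ∞ (EuclideanSpace ℝ (Fin n))
    (fun x : M ↦ TangentSpace (𝓡 n) x)]
  [IsRiemannianManifold (𝓡 n) M] {γ : ℝ → M} {L : ℝ}

theorem contMDiffOn_of_metric_geodesic (hL : 0 ≤ L)
    (hγ : ∀ s ∈ Icc (0 : ℝ) 1, ∀ t ∈ Icc (0 : ℝ) 1,
      edist (γ s) (γ t) = ENNReal.ofReal (L * |s - t|)) :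
    ContMDiffOn 𝓘(ℝ, ℝ) (𝓡 n) 2 γ (Icc 0 1) := by
  intro t₀ ht₀
  set φ := chartAt (EuclideanSpace ℝ (Fin n)) (γ t₀)
  have hφ : φ ∈ IsManifold.maximalAtlas (𝓡 n) ∞ M := IsManifold.chart_mem_maximalAtlas _
  obtain ⟨a, b, hab, htab, -, hnhds, hsrc, v, w, hw, hv, hvw, -⟩ :=
    exists_euler_lagrange_of_metric_geodesic hφ hL hγ ht₀ (mem_chart_source _ _)
  have h1 : ContDiffOn ℝ 2 (fun τ ↦ φ (γ τ)) (Icc a b) :=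
    contDiffOn_two_of_hasDerivWithinAt (uniqueDiffOn_Icc hab) hw.continuousOn hv hvw
  have h2 : ContMDiffOn 𝓘(ℝ, ℝ) (𝓡 n) 2 (φ.symm ∘ fun τ ↦ φ (γ τ)) (Icc a b) :=
    ((contMDiffOn_symm_of_mem_maximalAtlas hφ).of_le ENat.LEInfty.out).comp
      (contMDiffOn_iff_contDiffOn.2 h1) fun t ht ↦ φ.map_source (hsrc t ht)
  have h3 : ContMDiffOn 𝓘(ℝ, ℝ) (𝓡 n) 2 γ (Icc a b) :=
    h2.congr fun t ht ↦ (φ.left_inv (hsrc t ht)).symm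
  exact (h3 t₀ htab).mono_of_mem_nhdsWithin hnhds

theorem isGeodesicOn_of_metric_geodesic (hL : 0 ≤ L)
    (hγ : ∀ s ∈ Icc (0 : ℝ) 1, ∀ t ∈ Icc (0 : ℝ) 1,
      edist (γ s) (γ t) = ENNReal.ofReal (L * |s - t|)) :
    IsGeodesicOn (n := n) γ (Icc 0 1) := by
  refine ⟨contMDiffOn_of_metric_geodesic hL hγ, fun φ hφ t₀ ht₀ hsrc k ↦ ?_⟩
  obtain ⟨a, b, -, htab, hsub, hnhds, -, v, w, -, hv, hvw, hEL⟩ :=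
    exists_euler_lagrange_of_metric_geodesic hφ hL hγ ht₀ hsrc
  have hu : UniqueDiffOn ℝ (Icc (0 : ℝ) 1) := uniqueDiffOn_Icc zero_lt_one
  -- The second derivative requires the first one near `t₀`, not just at it; nearby points of `[a,
  -- b]` also have `[a, b]` as a relative neighbourhood.
  have hderiv : derivWithin (fun τ ↦ φ (γ τ)) (Icc 0 1) =ᶠ[𝓝[Icc 0 1] t₀] v := by
    filter_upwards [eventually_eventually_nhdsWithin.2 hnhds, hnhds] with t ht htab'
    have h1 : HasDerivWithinAt (fun τ ↦ φ (γ τ)) (v t) (Icc 0 1) t :=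
      (hv t htab').mono_of_mem_nhdsWithin ht
    exact h1.derivWithin (hu t (hsub htab'))
  have hderiv₀ := hderiv.eq_of_nhdsWithin ht₀
  rw [hderiv.derivWithin_eq hderiv₀, hderiv₀,
    ((hvw t₀ htab).mono_of_mem_nhdsWithin hnhds).derivWithin (hu t₀ ht₀)]
  exact add_sum_christoffel_eq_zero hφ (φ.map_source hsrc) (hEL t₀ htab) k

/-- Restricted to interior times, as `mfderiv` is two-sided; the endpoints do not affect the length.
-/
theorem enorm_mfderiv_le_of_metric_geodesic (hL : 0 ≤ L)
    (hγ : ∀ s ∈ Icc (0 : ℝ) 1, ∀ t ∈ Icc (0 : ℝ) 1,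
      edist (γ s) (γ t) = ENNReal.ofReal (L * |s - t|)) {t : ℝ} (ht : t ∈ Ioo (0 : ℝ) 1) :
    ‖mfderiv 𝓘(ℝ, ℝ) (𝓡 n) γ t 1‖ₑ ≤ ENNReal.ofReal L := by
  obtain ⟨φ, hφ, hsrc⟩ : ∃ φ ∈ IsManifold.maximalAtlas (𝓡 n) ∞ M, γ t ∈ φ.source :=
    ⟨_, IsManifold.chart_mem_maximalAtlas _, mem_chart_source (EuclideanSpace ℝ (Fin n)) (γ t)⟩
  have hnhds : Icc (0 : ℝ) 1 ∈ 𝓝 t := Icc_mem_nhds ht.1 ht.2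
  have hγt : ContMDiffAt 𝓘(ℝ, ℝ) (𝓡 n) 1 γ t :=
    ((contMDiffOn_of_metric_geodesic hL hγ).contMDiffAt hnhds).of_le one_le_two
  obtain ⟨y, hy⟩ : ∃ y : ℝ → EuclideanSpace ℝ (Fin n), y = fun τ ↦ φ (γ τ) := ⟨_, rfl⟩
  obtain ⟨v, hv⟩ : ∃ v, HasDerivAt y v t :=
    ⟨_, hy ▸ ((contDiffAt_chart_comp hφ hγt hsrc).differentiableAt one_ne_zero).hasDerivAt⟩
  have hyt : y t = φ (γ t) := congrFun hy t
  have hyt' : y t ∈ φ.target := hyt ▸ φ.map_source hsrc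
  have h1 : γ =ᶠ[𝓝 t] φ.symm ∘ y := hy ▸ eventuallyEq_symm_comp hγt.continuousAt hsrc
  have h2 : ∀ᶠ s in 𝓝 t, edist (φ.symm (y t)) (φ.symm (y s)) ≤ ENNReal.ofReal (L * |s - t|) := by
    filter_upwards [hnhds, h1] with s hs hs'
    rw [hyt, φ.left_inv hsrc, ← Function.comp_apply (f := φ.symm), ← hs',
      hγ t (Ioo_subset_Icc_self ht) s hs, abs_sub_comm]
  exact (enorm_mfderiv_eq_sqrt_chartForm hφ hv hyt' h1).trans_le
    (ENNReal.ofReal_le_ofReal (sqrt_chartForm_deriv_le hφ hv hyt' hL h2))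

theorem pathELength_le_of_metric_geodesic (hL : 0 ≤ L)
    (hγ : ∀ s ∈ Icc (0 : ℝ) 1, ∀ t ∈ Icc (0 : ℝ) 1,
      edist (γ s) (γ t) = ENNReal.ofReal (L * |s - t|)) :
    pathELength (𝓡 n) γ 0 1 ≤ ENNReal.ofReal L := by
  rw [pathELength_eq_lintegral_mfderiv_Ioo]
  refine (setLIntegral_mono' measurableSet_Ioo fun t ht ↦
    enorm_mfderiv_le_of_metric_geodesic hL hγ ht).trans_eq ?_
  simp

theorem isMinimizingGeodesic_of_metric_geodesic {p q : M} (hL : 0 ≤ L) (h0 : γ 0 = p) (h1 : γ 1 = q)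
    (hγ : ∀ s ∈ Icc (0 : ℝ) 1, ∀ t ∈ Icc (0 : ℝ) 1,
      edist (γ s) (γ t) = ENNReal.ofReal (L * |s - t|)) :
    IsMinimizingGeodesic (n := n) γ p q := by
  refine ⟨isGeodesicOn_of_metric_geodesic hL hγ, h0, h1, le_antisymm ?_ ?_⟩
  · refine (pathELength_le_of_metric_geodesic hL hγ).trans_eq ?_
    rw [← IsRiemannianManifold.out (I := 𝓡 n), ← h0, ← h1, hγ 0 (by simp) 1 (by simp)]
    simp
  · exact riemannianEDist_le_pathELength
      ((contMDiffOn_of_metric_geodesic hL hγ).of_le one_le_two) h0 h1 zero_le_one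

theorem exists_isMinimizingGeodesic {p q : M} {L R : ℝ} (hL : 0 ≤ L) (hR : 0 < R) (hLR : L ≤ R)
    (hpq : edist p q = ENNReal.ofReal L)
    (hK : IsCompact (closure (Metric.eball p (ENNReal.ofReal R))))
    (hq : q ∈ closure (Metric.eball p (ENNReal.ofReal R))) :
    ∃ γ : ℝ → M, IsMinimizingGeodesic (n := n) γ p q ∧
      ∀ t ∈ Icc (0 : ℝ) 1, edist (γ t) p = ENNReal.ofReal (L * t) := by
  obtain ⟨γ, h0, h1, hγ⟩ := exists_metric_geodesic (n := n) hL hR hLR hpq hK subset_closure hq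
  have hγ' := edist_eq_of_edist_le hL (by rw [h0, h1, hpq]) hγ
  refine ⟨γ, isMinimizingGeodesic_of_metric_geodesic hL h0 h1 hγ', fun t ht ↦ ?_⟩
  rw [← h0, hγ' t ht 0 (by simp), sub_zero, abs_of_nonneg ht.1]

end MinimizingGeodesic

end RiemannianGeodesic

/-! ### The main theorem -/

theorem propositionA2 {n : ℕ} {M : Type*} [EMetricSpace M]
    [ChartedSpace (EuclideanSpace ℝ (Fin n)) M] [IsManifold (𝓡 n) ∞ M]
    [Bundle.RiemannianBundle (fun x : M ↦ TangentSpace (𝓡 n) x)]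
    [IsContMDiffRiemannianBundle (𝓡 n) ∞ (EuclideanSpace ℝ (Fin n))
      (fun x : M ↦ TangentSpace (𝓡 n) x)]
    [IsRiemannianManifold (𝓡 n) M]
    (Ω : Set M) (hΩ_open : IsOpen Ω) (hΩ_conn : IsConnected Ω) (hΩ_cpt : IsCompact (closure Ω))
    (p : M) (R : ℝ) (hR : 0 < R) (hB : Metric.eball p (ENNReal.ofReal R) ⊆ Ω) :
    (∀ q ∈ frontier (Metric.eball p (ENNReal.ofReal R)),
      ∃ γ : ℝ → M, RiemannianGeodesic.IsMinimizingGeodesic (n := n) γ p q ∧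
        (∀ t ∈ Set.Icc (0 : ℝ) 1, γ t ∈ closure (Metric.eball p (ENNReal.ofReal R))) ∧
        ∀ t ∈ Set.Ico (0 : ℝ) 1, γ t ∈ Metric.eball p (ENNReal.ofReal R)) ∧
    (∀ q ∈ Metric.eball p (ENNReal.ofReal R),
      ∃ γ : ℝ → M, RiemannianGeodesic.IsMinimizingGeodesic (n := n) γ p q ∧
        ∀ t ∈ Set.Icc (0 : ℝ) 1, γ t ∈ Metric.eball p (ENNReal.ofReal R)) := by
  have hK : IsCompact (closure (Metric.eball p (ENNReal.ofReal R))) :=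
    hΩ_cpt.of_isClosed_subset isClosed_closure (closure_mono hB)
  refine ⟨fun q hq ↦ ?_, fun q hq ↦ ?_⟩
  · have hqc := frontier_subset_closure hq
    -- The closure of the ball lies in the closed ball, and a frontier point of the open ball is not
    -- in it, so the distance is exactly `R`.
    have hpq : edist p q = ENNReal.ofReal R := by
      rw [edist_comm]
      refine le_antisymm ?_ ?_
      · exact closure_minimal Metric.eball_subset_closedEBall Metric.isClosed_closedEBall hqc
      · rw [Metric.isOpen_eball.frontier_eq] at hq
        exact not_lt.1 hq.2
    obtain ⟨γ, hγ, hd⟩ :=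
      RiemannianGeodesic.exists_isMinimizingGeodesic (n := n) hR.le hR le_rfl hpq hK hqc
    have hball : ∀ t ∈ Set.Ico (0 : ℝ) 1, γ t ∈ Metric.eball p (ENNReal.ofReal R) := by
      intro t ht
      rw [Metric.mem_eball, hd t ⟨ht.1, ht.2.le⟩, ENNReal.ofReal_lt_ofReal_iff hR]
      nlinarith [ht.2]
    refine ⟨γ, hγ, fun t ht ↦ ?_, hball⟩
    rcases ht.2.eq_or_lt with rfl | h
    · rwa [hγ.target]
    · exact subset_closure (hball t ⟨ht.1, h⟩)
  · have hfin : edist p q ≠ ⊤ := by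
      rw [edist_comm]
      exact (lt_of_lt_of_le hq le_top).ne
    have hpq := (ENNReal.ofReal_toReal hfin).symm
    have hL : (edist p q).toReal < R := by
      rw [← ENNReal.ofReal_lt_ofReal_iff hR, ← hpq, edist_comm]
      exact hq
    obtain ⟨γ, hγ, hd⟩ := RiemannianGeodesic.exists_isMinimizingGeodesic (n := n)
      ENNReal.toReal_nonneg hR hL.le hpq hK (subset_closure hq)
    refine ⟨γ, hγ, fun t ht ↦ ?_⟩
    rw [Metric.mem_eball, hd t ht, ENNReal.ofReal_lt_ofReal_iff hR]
    exact (mul_le_of_le_one_right ENNReal.toReal_nonneg ht.2).trans_lt hL
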